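/- Let $N$ be a $\tau$-group, that is, a finitely generated torsion-free nilpotent group, and let $x_1,\dots,x_h$ be a Mal'cev basis of $N$: with $N_i=\langle x_i,\dots,x_h\rangle$, one has $N_1=N$, $[N_i,N]\le N_{i+1}$ for all $i$ (with $N_{h+1}=1$), and each $N_i/N_{i+1}$ is infinite cyclic (generated by the class of $x_i$). For integers $a_i$ write $\mathbf x^{\mathbf a}=x_1^{a_1}\cdots x_h^{a_h}$. For a prime $p$ let $N_p$ be the pro-$p$ completion of $N$; the same notation $\mathbf x^{\mathbf a}\in N_p$ is used for $\mathbf a\in\mathbb Z_p^h$. Let $Tr(h,\mathbb Z_p)$ be the set of upper triangular $h\times h$ matrices $\mathbf t=(t_{ij})$ over $\mathbb Z_p$, with rows $\mathbf t_1,\dots,\mathbf t_h$. Such a $\mathbf t$ represents a good basis for a subgroup $B\le N_p$ if $B=\{(\mathbf x^{\mathbf t_1})^{\lambda_1}\cdots(\mathbf x^{\mathbf t_h})^{\lambda_h}:\lambda_1,\dots,\lambda_h\in\mathbb Z_p\}$. For $a,b\in\mathbb Q_p$, $a\mid b$ means $b\in a\mathbb Z_p$. Let $\mathbf T=(T_{ij})_{1\le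 i\le j\le h}$ and $\mathbf Z=(Z_1,\dots,Z_h)$ be variables. (1) There are $h$-tuples of polynomials $\mathbf f(\mathbf X,\mathbf Y)$ and $\mathbf g(\mathbf X,W)$ over $\mathbb Q$ such that $\mathbf x^{\mathbf a}\mathbf x^{\mathbf b}=\mathbf x^{\mathbf f(\mathbf a,\mathbf b)}$ and $(\mathbf x^{\mathbf a})^w=\mathbf x^{\mathbf g(\mathbf a,w)}$ for all $\mathbf a,\mathbf b\in\mathbb Z^h$, $w\in\mathbb Z$. (2) Let $\mathbf f,\mathbf g$ be any polynomials as in (1). For a vector $\mathbf v$ put $\mathbf v^{i}=(0,\dots,0,v_i,\dots,v_h)$, and put $\mathbf T_i=(0,\dots,0,T_{ii},\dots,T_{ih})$. Define vectors $\mathbf k_1,\dots,\mathbf k_h$ and elements $v_1,\dots,v_h$ of $\mathbb Q(\mathbf T,\mathbf Z)$ recursively by $\mathbf k_1=\mathbf Z$, $v_i=k_{ii}/T_{ii}$ (where $k_{ii}$ is the $i$-th entry of $\mathbf k_i$), and $$\mathbf k_{i+1}=\mathbf f\bigl(\mathbf g(\mathbf g^{i+1}(\mathbf T_i,v_i),-1),\,\mathbf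 k_i^{i+1}\bigr)\qquad(1\le i<h).$$ Then one can write $v_i=p_i/q_i$ with $p_i\in\mathbb Q[\mathbf T,\mathbf Z]$ and $q_i$ a monomial (product of powers) in $T_{11},\dots,T_{hh}$, for $i=1,\dots,h$. For any such $p_i,q_i$, every prime $p$, every $\mathbf t\in Tr(h,\mathbb Z_p)$ representing a good basis for some open subgroup of $N_p$, and every $\mathbf z\in\mathbb Z_p^h$, $$\mathbf x^{\mathbf z}\in\overline{\langle\mathbf x^{\mathbf t_1},\dots,\mathbf x^{\mathbf t_h}\rangle}\iff q_i(\mathbf t,\mathbf z)\mid p_i(\mathbf t,\mathbf z)\ \text{ for } i=1,\dots,h .$$ (3) There are a finite set $I$ and polynomials $r_i,s_i\in\mathbb Q[\mathbf T]$ $(i\in I)$ such that, for every prime $p$, the set of all $\mathbf t\in Tr(h,\mathbb Z_p)$ representing a good basis for some open subgroup of $N_p$ equals $$\{\mathbf t\in Tr(h,\mathbb Z_p): t_{11}\cdots t_{hh}\ne0,\ s_i(\mathbf t)\mid r_i(\mathbf t)\ \text{ for all } i\in I\}.$$ (4) The same holds (with possibly other $I,r_i,s_i$) for the set of all $\mathbf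 t\in Tr(h,\mathbb Z_p)$ representing a good basis for some open normal subgroup of $N_p$. -/

import Mathlib

/-! ### Pro-`p` completion and `p`-adic powers -/

/-- The normal subgroups of `p`-power index in `N`. -/
structure PIndexNormal (p : ℕ) (N : Type*) [Group N] where
  /-- the underlying subgroup -/
  toSubgroup : Subgroup N
  normal : toSubgroup.Normal
  index_eq : ∃ n : ℕ, toSubgroup.index = p ^ n

instance PIndexNormal.instNormal {p : ℕ} {N : Type*} [Group N] (K : PIndexNormal p N) :
    K.toSubgroup.Normal := K.normal

/-- The compatible families `(g_K)_K` in the product of the finite quotients `N ⧸ K`, where `K` runs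
through the normal subgroups of `p`-power index. -/
def compatibleFamilies (p : ℕ) (N : Type*) [Group N] :
    Subgroup (∀ K : PIndexNormal p N, N ⧸ K.toSubgroup) where
  carrier := {g | ∀ (K L : PIndexNormal p N) (hKL : K.toSubgroup ≤ L.toSubgroup),
    QuotientGroup.map K.toSubgroup L.toSubgroup (MonoidHom.id N) hKL (g K) = g L}
  one_mem' := by
    intro K L hKL
    simp only [Pi.one_apply, map_one]
  mul_mem' := by
    intro a b ha hb K L hKL
    simp only [Pi.mul_apply, map_mul, ha K L hKL, hb K L hKL]
  inv_mem' := by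
    intro a ha K L hKL
    simp only [Pi.inv_apply, map_inv, ha K L hKL]

/-- The pro-`p` completion `N_p`: the inverse limit of the quotients of `N` by normal subgroups of
`p`-power index. -/
abbrev ProPCompletion (p : ℕ) (N : Type*) [Group N] : Type _ :=
  compatibleFamilies p N

/-- The topology of the inverse limit: induced by the product of the discrete topologies on the
quotients `N ⧸ K`. -/
instance ProPCompletion.instTopologicalSpace (p : ℕ) (N : Type*) [Group N] :
    TopologicalSpace (ProPCompletion p N) :=
  ⨅ K : PIndexNormal p N, TopologicalSpace.induced
    (fun g : ProPCompletion p N => (g : ∀ K : PIndexNormal p N, N ⧸ K.toSubgroup) K) ⊥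

/-- The canonical homomorphism `N → N_p`. -/
def toProP (p : ℕ) {N : Type*} [Group N] : N →* ProPCompletion p N where
  toFun g := ⟨fun _ => QuotientGroup.mk g, fun _ _ _ => rfl⟩
  map_one' := rfl
  map_mul' _ _ := rfl

theorem PIndexNormal.pow_eq_one {p : ℕ} {N : Type*} [Group N] (L : PIndexNormal p N)
    [hp : Fact p.Prime] (y : N ⧸ L.toSubgroup) :
    y ^ (p ^ padicValNat p L.toSubgroup.index) = 1 := by
  obtain ⟨n, hn⟩ := L.index_eq
  rw [hn, padicValNat.prime_pow, ← hn, Subgroup.index_eq_card]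
  exact pow_card_eq_one'

/-- The `p`-adic power `g ^ a` in the pro-`p` group `N_p`, that is, the limit of `g ^ n` as the
natural number `n` tends to `a` in `ℤ_p`. In a quotient `N ⧸ K` of order `p ^ m` it is `g_K ^ n` for
any natural number `n` congruent to `a` modulo `p ^ m`. -/
noncomputable def padicPow {p : ℕ} [Fact p.Prime] {N : Type*} [Group N]
    (g : ProPCompletion p N) (a : ℤ_[p]) : ProPCompletion p N :=
  ⟨fun K => (g : ∀ K : PIndexNormal p N, N ⧸ K.toSubgroup) K ^
      a.appr (padicValNat p K.toSubgroup.index), by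
    intro K L hKL
    dsimp only
    rw [map_pow, g.2 K L hKL]
    have hle : padicValNat p L.toSubgroup.index ≤ padicValNat p K.toSubgroup.index := by
      have hK : K.toSubgroup.index ≠ 0 := by
        obtain ⟨n, hn⟩ := K.index_eq
        rw [hn]
        exact pow_ne_zero _ (Fact.out : p.Prime).ne_zero
      exact padicValNat_dvd_iff_le hK |>.1
        (pow_padicValNat_dvd.trans (Subgroup.index_dvd_of_le hKL))
    obtain ⟨c, hc⟩ := PadicInt.dvd_appr_sub_appr a _ _ hle
    have hmono : a.appr (padicValNat p L.toSubgroup.index) ≤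
        a.appr (padicValNat p K.toSubgroup.index) := PadicInt.appr_mono a hle
    have heq : a.appr (padicValNat p K.toSubgroup.index) =
        a.appr (padicValNat p L.toSubgroup.index) +
          p ^ padicValNat p L.toSubgroup.index * c := by omega
    rw [heq, pow_add, pow_mul, PIndexNormal.pow_eq_one, one_pow, mul_one]⟩

/-! ### Mal'cev bases -/

/-- The subgroup `⟨x_i, x_{i+1}, …⟩` (indices start at `0`). -/
def tailSubgroup {N : Type*} [Group N] {h : ℕ} (x : Fin h → N) (i : ℕ) : Subgroup N :=
  Subgroup.closure {g | ∃ j : Fin h, i ≤ (j : ℕ) ∧ x j = g}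

/-- `x` is a Mal'cev basis of `N`: the subgroups `N_i = ⟨x_i, …, x_h⟩` form a central series of `N`
(hence each is normal in `N`), and each `N_i / N_{i+1}`, which is generated by the class of `x_i`,
is infinite cyclic. -/
structure IsMalcevBasis {N : Type*} [Group N] {h : ℕ} (x : Fin h → N) : Prop where
  generates : tailSubgroup x 0 = ⊤
  central : ∀ i : ℕ, ⁅tailSubgroup x i, (⊤ : Subgroup N)⁆ ≤ tailSubgroup x (i + 1)
  infinite_cyclic : ∀ (i : Fin h) (n : ℤ), x i ^ n ∈ tailSubgroup x (i + 1) → n = 0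

/-- `x_1 ^ a_1 ⋯ x_h ^ a_h` in `N`, for integers `a_i`. -/
def intMonomial {N : Type*} [Group N] {h : ℕ} (x : Fin h → N) (a : Fin h → ℤ) : N :=
  (List.ofFn fun i => x i ^ a i).prod

/-- `y_1 ^ a_1 ⋯ y_m ^ a_m` in `N_p`, for `p`-adic integers `a_i`. -/
noncomputable def padicMonomial {p : ℕ} [Fact p.Prime] {N : Type*} [Group N] {m : ℕ}
    (y : Fin m → ProPCompletion p N) (a : Fin m → ℤ_[p]) : ProPCompletion p N :=
  (List.ofFn fun i => padicPow (y i) (a i)).prod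

/-- `𝐱 ^ a = x_1 ^ a_1 ⋯ x_h ^ a_h` in `N_p`, for elements `x_i` of `N`. -/
noncomputable def xPow {p : ℕ} [Fact p.Prime] {N : Type*} [Group N] {h : ℕ} (x : Fin h → N)
    (a : Fin h → ℤ_[p]) : ProPCompletion p N :=
  padicMonomial (fun i => toProP p (x i)) a

/-! ### Good bases -/

/-- `Tr(h, ℤ_p)`: the upper triangular matrices. -/
def Tr (h p : ℕ) [Fact p.Prime] : Set (Matrix (Fin h) (Fin h) ℤ_[p]) :=
  {t | t.BlockTriangular id}

/-- The matrix `t`, with rows `t_1, …, t_h`, represents a good basis for the subgroup `B` of `N_p`: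
it is upper triangular and
`B = {(𝐱 ^ t_1) ^ l_1 ⋯ (𝐱 ^ t_h) ^ l_h : l_1, …, l_h ∈ ℤ_p}`. -/
def IsGoodBasis {p : ℕ} [Fact p.Prime] {N : Type*} [Group N] {h : ℕ} (x : Fin h → N)
    (t : Matrix (Fin h) (Fin h) ℤ_[p]) (B : Subgroup (ProPCompletion p N)) : Prop :=
  t ∈ Tr h p ∧
    (B : Set (ProPCompletion p N)) =
      Set.range fun l : Fin h → ℤ_[p] => padicMonomial (fun i => xPow x (t i)) l

/-- The matrices representing a good basis for some open subgroup of `N_p`. -/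
def goodBases (p : ℕ) [Fact p.Prime] {N : Type*} [Group N] {h : ℕ} (x : Fin h → N) :
    Set (Matrix (Fin h) (Fin h) ℤ_[p]) :=
  {t | ∃ B : Subgroup (ProPCompletion p N),
    IsOpen (B : Set (ProPCompletion p N)) ∧ IsGoodBasis x t B}

/-- The matrices representing a good basis for some open normal subgroup of `N_p`. -/
def normalGoodBases (p : ℕ) [Fact p.Prime] {N : Type*} [Group N] {h : ℕ} (x : Fin h → N) :
    Set (Matrix (Fin h) (Fin h) ℤ_[p]) :=
  {t | ∃ B : Subgroup (ProPCompletion p N),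
    B.Normal ∧ IsOpen (B : Set (ProPCompletion p N)) ∧ IsGoodBasis x t B}

/-- The topological closure in `N_p` of the subgroup generated by `𝐱 ^ t_1, …, 𝐱 ^ t_h`. -/
def closedSpan {p : ℕ} [Fact p.Prime] {N : Type*} [Group N] {h : ℕ} (x : Fin h → N)
    (t : Matrix (Fin h) (Fin h) ℤ_[p]) : Set (ProPCompletion p N) :=
  closure (Subgroup.closure (Set.range fun i => xPow x (t i)) : Set (ProPCompletion p N))

/-! ### Polynomial conditions -/

/-- The index set of the variables `T_ij`, `i ≤ j`. -/
abbrev TVar (h : ℕ) : Type := {ij : Fin h × Fin h // ij.1 ≤ ij.2}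

/-- The index `(i, i)` of a diagonal variable. -/
def TVar.diag {h : ℕ} (i : Fin h) : TVar h := ⟨(i, i), le_refl i⟩

/-- The entries `t_ij`, `i ≤ j`, of a matrix, in `ℚ_p`. -/
def entries {p : ℕ} [Fact p.Prime] {h : ℕ} (t : Matrix (Fin h) (Fin h) ℤ_[p]) : TVar h → ℚ_[p] :=
  fun ij => (t ij.1.1 ij.1.2 : ℚ_[p])

/-- `s ∣ r` for `r, s ∈ ℚ_p` means `r ∈ s ℤ_p`, i.e. `v_p(s) ≤ v_p(r)`. -/
def PadicDvd {p : ℕ} [Fact p.Prime] (s r : ℚ_[p]) : Prop :=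
  ∃ c : ℤ_[p], r = s * (c : ℚ_[p])

/-- `{t ∈ Tr(h, ℤ_p) : t_11 ⋯ t_hh ≠ 0, s_i(t) ∣ r_i(t) for all i}`. -/
def coneSet (p : ℕ) [Fact p.Prime] {h n : ℕ} (r s : Fin n → MvPolynomial (TVar h) ℚ) :
    Set (Matrix (Fin h) (Fin h) ℤ_[p]) :=
  {t | t ∈ Tr h p ∧ ∏ i, t i i ≠ 0 ∧
    ∀ i, PadicDvd (MvPolynomial.aeval (entries t) (s i)) (MvPolynomial.aeval (entries t) (r i))}

/-! ### The polynomials of a Mal'cev basis and the membership algorithm -/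

/-- `f(a, b)` for an `h`-tuple of polynomials `f` in `(X, Y)`. -/
noncomputable def evalMul {h : ℕ} {F : Type*} [Field F] [Algebra ℚ F]
    (f : Fin h → MvPolynomial (Fin h ⊕ Fin h) ℚ) (a b : Fin h → F) : Fin h → F :=
  fun i => MvPolynomial.aeval (Sum.elim a b) (f i)

/-- `g(a, w)` for an `h`-tuple of polynomials `g` in `(X, W)`. -/
noncomputable def evalPow {h : ℕ} {F : Type*} [Field F] [Algebra ℚ F]
    (g : Fin h → MvPolynomial (Fin h ⊕ Unit) ℚ) (a : Fin h → F) (w : F) : Fin h → F :=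
  fun i => MvPolynomial.aeval (Sum.elim a fun _ => w) (g i)

/-- `𝐱 ^ a * 𝐱 ^ b = 𝐱 ^ f(a, b)` for all integral vectors `a, b` (with `f(a, b)` integral). -/
def IsMulPolynomials {N : Type*} [Group N] {h : ℕ} (x : Fin h → N)
    (f : Fin h → MvPolynomial (Fin h ⊕ Fin h) ℚ) : Prop :=
  ∀ a b : Fin h → ℤ, ∃ c : Fin h → ℤ,
    (fun i => (c i : ℚ)) = evalMul f (fun i => (a i : ℚ)) (fun i => (b i : ℚ)) ∧
      intMonomial x a * intMonomial x b = intMonomial x c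

/-- `(𝐱 ^ a) ^ w = 𝐱 ^ g(a, w)` for all integral vectors `a` and integers `w`
(with `g(a, w)` integral). -/
def IsPowPolynomials {N : Type*} [Group N] {h : ℕ} (x : Fin h → N)
    (g : Fin h → MvPolynomial (Fin h ⊕ Unit) ℚ) : Prop :=
  ∀ (a : Fin h → ℤ) (w : ℤ), ∃ c : Fin h → ℤ,
    (fun i => (c i : ℚ)) = evalPow g (fun i => (a i : ℚ)) (w : ℚ) ∧
      intMonomial x a ^ w = intMonomial x c

/-- `v^i = (0, …, 0, v_i, …, v_h)` (indices start at `0`). -/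
def truncate {h : ℕ} {F : Type*} [Zero F] (i : ℕ) (v : Fin h → F) : Fin h → F :=
  fun j => if i ≤ (j : ℕ) then v j else 0

/-- The row `T_i = (0, …, 0, T_ii, …, T_ih)`. -/
def rowVector {h : ℕ} {F : Type*} [Zero F] (T : TVar h → F) (i : Fin h) : Fin h → F :=
  fun j => if hij : i ≤ j then T ⟨(i, j), hij⟩ else 0

/-- The vectors `k_1, …, k_h` of the algorithm (indices start at `0`), with the values
`w_j = k_jj / T_jj` already substituted for the auxiliary variables `W_j`:
`k_1 = Z` and `k_{i+1} = f(g(g^{i+1}(T_i, w_i), -1), k_i^{i+1})`, where `w_i = k_ii / T_ii`. -/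
noncomputable def kVector {h : ℕ} {F : Type*} [Field F] [Algebra ℚ F]
    (f : Fin h → MvPolynomial (Fin h ⊕ Fin h) ℚ) (g : Fin h → MvPolynomial (Fin h ⊕ Unit) ℚ)
    (T : TVar h → F) (Z : Fin h → F) : (i : ℕ) → i < h → Fin h → F
  | 0, _ => Z
  | i + 1, hi =>
    let i' : Fin h := ⟨i, Nat.lt_of_succ_lt hi⟩
    let k : Fin h → F := kVector f g T Z i i'.2
    let w : F := k i' / T (TVar.diag i')
    evalMul f (evalPow g (truncate (i + 1) (evalPow g (rowVector T i') w)) (-1))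
      (truncate (i + 1) k)

/-- `v_i = k_ii / T_ii`. -/
noncomputable def vValue {h : ℕ} {F : Type*} [Field F] [Algebra ℚ F]
    (f : Fin h → MvPolynomial (Fin h ⊕ Fin h) ℚ) (g : Fin h → MvPolynomial (Fin h ⊕ Unit) ℚ)
    (T : TVar h → F) (Z : Fin h → F) (i : Fin h) : F :=
  kVector f g T Z i i.2 i / T (TVar.diag i)

/-- The field `ℚ(T, Z)` of rational functions. -/
abbrev RatTZ (h : ℕ) : Type := FractionRing (MvPolynomial (TVar h ⊕ Fin h) ℚ)

/-- The rational functions `v_i(T, Z) ∈ ℚ(T, Z)` produced by the algorithm. -/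
noncomputable def vRat {h : ℕ} (f : Fin h → MvPolynomial (Fin h ⊕ Fin h) ℚ)
    (g : Fin h → MvPolynomial (Fin h ⊕ Unit) ℚ) (i : Fin h) : RatTZ h :=
  vValue f g
    (fun ij => algebraMap (MvPolynomial (TVar h ⊕ Fin h) ℚ) (RatTZ h) (MvPolynomial.X (Sum.inl ij)))
    (fun j => algebraMap (MvPolynomial (TVar h ⊕ Fin h) ℚ) (RatTZ h) (MvPolynomial.X (Sum.inr j)))
    i

/-- `(P_i)`, `(Q_i)` is an output of the algorithm: `v_i = P_i / Q_i` with `Q_i` a monomial in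
`T_11, …, T_hh`. -/
def IsAlgorithmOutput {h : ℕ} (f : Fin h → MvPolynomial (Fin h ⊕ Fin h) ℚ)
    (g : Fin h → MvPolynomial (Fin h ⊕ Unit) ℚ)
    (P Q : Fin h → MvPolynomial (TVar h ⊕ Fin h) ℚ) : Prop :=
  ∀ i, (∃ m : Fin h → ℕ, Q i = ∏ j, MvPolynomial.X (Sum.inl (TVar.diag j)) ^ m j) ∧
    vRat f g i = algebraMap (MvPolynomial (TVar h ⊕ Fin h) ℚ) (RatTZ h) (P i) /
      algebraMap (MvPolynomial (TVar h ⊕ Fin h) ℚ) (RatTZ h) (Q i)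

/-- The value of a polynomial in `(T, Z)` at `(t, z)`. -/
noncomputable def evalTZ {p : ℕ} [Fact p.Prime] {h : ℕ} (P : MvPolynomial (TVar h ⊕ Fin h) ℚ)
    (t : Matrix (Fin h) (Fin h) ℤ_[p]) (z : Fin h → ℤ_[p]) : ℚ_[p] :=
  MvPolynomial.aeval (Sum.elim (entries t) fun i => (z i : ℚ_[p])) P

/-!
The theorem reduces every assertion to polynomial identities in Mal'cev coordinates.

*Multiplication and powers are polynomial* (`IsMalcevBasis.polyMul`). By downward induction on `k`,
products of polynomial maps into `⟨x_k, …, x_h⟩` are polynomial: after moving the powers of `x_k` to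
the front, only products in `⟨x_{k+1}, …, x_h⟩` and conjugates by variable powers of `x_k` are left.
Since `N_i / N_{i+1}` is central, the `i`-th coordinate of `u v` is `u_i + v_i` plus a term in the
previous coordinates (`IsMalcevBasis.coord_mul`), and similarly for conjugation, so that iterates
are obtained by summing polynomials (`IsPolyFun.of_difference`).

*Passage to `N_p`.* The map `a ↦ x ^ a` is a homeomorphism from `ℤ_p ^ h` to `N_p`
(`IsMalcevBasis.xPowHomeo`): it is injective because there are normal subgroups of `p`-power index
all of whose elements have coordinates divisible by a given power of `p`, and surjective by
compactness. As `ℤ ^ h` is dense in `ℤ_p ^ h`, the polynomials describe the group law of `N_p` too.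

*Membership* (`IsMalcevBasis.xPow_mem_range_iff`). For upper triangular `t` with nonzero diagonal,
comparing leading coordinates shows that `x ^ z` is of the form
`(x ^ t_1) ^ l_1 ⋯ (x ^ t_h) ^ l_h` with `l_i ∈ ℤ_p` exactly if the values `v_i(t, z)` of the
algorithm lie in `ℤ_p`; then `l_i = v_i(t, z)`. This holds whether or not these products form a
subgroup. If they do form an open subgroup, they are the closed span of the `x ^ t_i`.

*Good bases.* The products form an open subgroup exactly if the diagonal of `t` does not vanish and
all quotients of two products are products (`IsMalcevBasis.mem_goodBases_iff`); normality is the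
corresponding statement for conjugates. By the membership criterion, this says that finitely many
polynomials in parameters `l`, divided by monomials in the `t_ii`, take values in `ℤ_p` for all
`p`-adic integral `l`. An integrality statement of this kind need only be tested for `l` in a finite
grid, whose size depends only on the degree (`MvPolynomial.norm_aeval_le_one`), and this yields
finitely many divisibility conditions on `t`, independent of `p`
(`IsPadicPolyFamily.exists_coneSet`).
-/

/-! ### Coordinates with respect to a Mal'cev basis -/

theorem List.prod_ofFn_truncate {G : Type*} [Monoid G] : ∀ {h : ℕ} (g : Fin h → G) (k : Fin h),
    (List.ofFn fun i => if (k : ℕ) ≤ (i : ℕ) then g i else 1).prod =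
      g k * (List.ofFn fun i => if (k : ℕ) + 1 ≤ (i : ℕ) then g i else 1).prod
  | 0, _, k => k.elim0
  | h + 1, g, k => by
    refine Fin.cases ?_ (fun k => ?_) k
    · simp [List.ofFn_succ]
    · simpa [List.ofFn_succ] using List.prod_ofFn_truncate (fun i => g i.succ) k

theorem List.prod_ofFn_split {G : Type*} [Monoid G] : ∀ {h : ℕ} (g : Fin h → G) (k : ℕ),
    (List.ofFn g).prod = (List.ofFn fun i => if (i : ℕ) < k then g i else 1).prod *
      (List.ofFn fun i => if k ≤ (i : ℕ) then g i else 1).prod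
  | 0, _, _ => by simp
  | h + 1, g, 0 => by simp
  | h + 1, g, k + 1 => by
    have := List.prod_ofFn_split (fun i => g i.succ) k
    simp only [List.ofFn_succ, List.prod_cons, Fin.val_zero, Fin.val_succ, Nat.zero_lt_succ, if_true,
      Nat.succ_lt_succ_iff, Nat.add_le_add_iff_right, mul_assoc, this]
    simp

section Discrete

open scoped commutatorElement

variable {N : Type*} [Group N] {h : ℕ} {x : Fin h → N}

theorem truncate_of_le {F : Type*} [Zero F] {i : ℕ} (hi : h ≤ i) (v : Fin h → F) :
    truncate i v = 0 := by
  funext j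
  have := j.2
  simp only [truncate, Pi.zero_apply, ite_eq_right_iff]
  omega

theorem truncate_zero {F : Type*} [Zero F] (v : Fin h → F) : truncate 0 v = v := by
  funext j
  simp [truncate]

theorem truncate_truncate {F : Type*} [Zero F] {i j : ℕ} (hij : i ≤ j) (v : Fin h → F) :
    truncate i (truncate j v) = truncate j v := by
  funext l
  simp only [truncate]
  split_ifs <;> first | rfl | omega

/-- The complement `(v_1, …, v_{i-1}, 0, …, 0)` of `truncate i v` (indices start at `0`). -/
def headVector {F : Type*} [Zero F] (i : ℕ) (v : Fin h → F) : Fin h → F :=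
  fun j => if (j : ℕ) < i then v j else 0

theorem intMonomial_zero (x : Fin h → N) : intMonomial x 0 = 1 := by
  simp [intMonomial]

theorem zpow_ite_zero (c : Prop) [Decidable c] (y : N) (n : ℤ) :
    y ^ (if c then n else 0) = if c then y ^ n else 1 := by
  split_ifs <;> simp

theorem intMonomial_truncate (x : Fin h → N) (k : Fin h) (a : Fin h → ℤ) :
    intMonomial x (truncate k a) = x k ^ a k * intMonomial x (truncate (k + 1) a) := by
  have := List.prod_ofFn_truncate (fun i => x i ^ a i) k
  simpa only [intMonomial, truncate, zpow_ite_zero] using this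

theorem intMonomial_split (x : Fin h → N) (k : ℕ) (a : Fin h → ℤ) :
    intMonomial x a = intMonomial x (headVector k a) * intMonomial x (truncate k a) := by
  have := List.prod_ofFn_split (fun i => x i ^ a i) k
  simpa only [intMonomial, truncate, headVector, zpow_ite_zero] using this

theorem intMonomial_head_mul_truncate (x : Fin h → N) (k : ℕ) (a b : Fin h → ℤ) :
    intMonomial x (headVector k a) * intMonomial x (truncate k b) =
      intMonomial x fun i => if (i : ℕ) < k then a i else b i := by
  rw [intMonomial_split x k fun i => if (i : ℕ) < k then a i else b i]
  congr 2 <;> funext i <;> simp only [headVector, truncate] <;> split_ifs <;> first | rfl | omega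

theorem mem_tailSubgroup (x : Fin h → N) {i : ℕ} {j : Fin h} (hij : i ≤ j) :
    x j ∈ tailSubgroup x i :=
  Subgroup.subset_closure ⟨j, hij, rfl⟩

theorem tailSubgroup_antitone (x : Fin h → N) : Antitone (tailSubgroup x) := by
  intro i j hij
  refine Subgroup.closure_mono ?_
  rintro g ⟨l, hl, rfl⟩
  exact ⟨l, hij.trans hl, rfl⟩

theorem tailSubgroup_of_le (x : Fin h → N) {i : ℕ} (hi : h ≤ i) : tailSubgroup x i = ⊥ := by
  rw [tailSubgroup, Subgroup.closure_eq_bot_iff]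
  rintro g ⟨l, hl, rfl⟩
  have := l.2
  omega

theorem intMonomial_mem_tailSubgroup (x : Fin h → N) {i : ℕ} {a : Fin h → ℤ}
    (ha : ∀ j : Fin h, (j : ℕ) < i → a j = 0) : intMonomial x a ∈ tailSubgroup x i := by
  refine Subgroup.list_prod_mem _ fun g hg => ?_
  obtain ⟨j, rfl⟩ := List.mem_ofFn.1 hg
  by_cases hj : (j : ℕ) < i
  · simp [ha j hj]
  · exact Subgroup.zpow_mem _ (mem_tailSubgroup x (not_lt.1 hj)) _

theorem intMonomial_truncate_mem (x : Fin h → N) (i : ℕ) (a : Fin h → ℤ) :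
    intMonomial x (truncate i a) ∈ tailSubgroup x i :=
  intMonomial_mem_tailSubgroup x fun j hj => by simp [truncate, not_le.2 hj]

namespace IsMalcevBasis

theorem tail_normal (hx : IsMalcevBasis x) (i : ℕ) : (tailSubgroup x i).Normal := by
  refine ⟨fun n hn g => ?_⟩
  have h1 : ⁅n, g⁆ ∈ tailSubgroup x i :=
    tailSubgroup_antitone x i.le_succ
      (hx.central i (Subgroup.commutator_mem_commutator hn (Subgroup.mem_top g)))
  have h2 : g * n * g⁻¹ = (⁅n, g⁆)⁻¹ * n := by
    simp only [commutatorElement_def]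
    group
  rw [h2]
  exact mul_mem (inv_mem h1) hn

theorem exists_eq_truncate (hx : IsMalcevBasis x) (i : ℕ) (u : N) (hu : u ∈ tailSubgroup x i) :
    ∃ a : Fin h → ℤ, u = intMonomial x (truncate i a) := by
  rcases le_total h i with hi | hi
  · rw [tailSubgroup_of_le x hi, Subgroup.mem_bot] at hu
    exact ⟨0, by rw [truncate_of_le hi, intMonomial_zero, hu]⟩
  induction hi using Nat.decreasingInduction generalizing u with
  | self =>
    rw [tailSubgroup_of_le x le_rfl, Subgroup.mem_bot] at hu
    exact ⟨0, by rw [truncate_of_le le_rfl, intMonomial_zero, hu]⟩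
  | of_succ k hk ih =>
    let k' : Fin h := ⟨k, hk⟩
    have hle : tailSubgroup x k ≤ Subgroup.zpowers (x k') ⊔ tailSubgroup x (k + 1) := by
      rw [tailSubgroup, Subgroup.closure_le]
      rintro g ⟨j, hj, rfl⟩
      rcases hj.eq_or_lt with hj | hj
      · have : j = k' := Fin.ext hj.symm
        exact this ▸ Subgroup.mem_sup_left (Subgroup.mem_zpowers _)
      · exact Subgroup.mem_sup_right (mem_tailSubgroup x hj)
    have := hx.tail_normal (k + 1)
    obtain ⟨y, hy, z, hz, rfl⟩ := Subgroup.mem_sup_of_normal_right.1 (hle hu)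
    obtain ⟨n, rfl⟩ := Subgroup.mem_zpowers_iff.1 hy
    obtain ⟨a, rfl⟩ := ih z hz
    refine ⟨Function.update a k' n, ?_⟩
    have h1 := intMonomial_truncate x k' (Function.update a k' n)
    rw [Function.update_self] at h1
    change _ = intMonomial x (truncate (k' : ℕ) _)
    rw [h1]
    congr 2
    funext j
    simp only [truncate]
    split_ifs with hj
    · rw [Function.update_of_ne]
      rintro rfl
      exact absurd hj (by simp [k'])
    · rfl

theorem truncate_injective (hx : IsMalcevBasis x) (i : ℕ) (a b : Fin h → ℤ)
    (hab : intMonomial x (truncate i a) = intMonomial x (truncate i b)) :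
    truncate i a = truncate i b := by
  rcases le_total h i with hi | hi
  · rw [truncate_of_le hi, truncate_of_le hi]
  induction hi using Nat.decreasingInduction with
  | self => rw [truncate_of_le le_rfl, truncate_of_le le_rfl]
  | of_succ k hk ih =>
    let k' : Fin h := ⟨k, hk⟩
    have ha := intMonomial_truncate x k' a
    have hb := intMonomial_truncate x k' b
    have hab' : x k' ^ a k' * intMonomial x (truncate (k + 1) a) =
        x k' ^ b k' * intMonomial x (truncate (k + 1) b) := by
      rw [← ha, ← hb]
      exact hab
    have h1 : x k' ^ (a k' - b k') ∈ tailSubgroup x (k + 1) := by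
      have : x k' ^ (a k' - b k') = (x k' ^ b k')⁻¹ * (x k' ^ a k') := by
        rw [← zpow_neg, ← zpow_add]
        congr 1
        ring
      rw [this, eq_mul_inv_of_mul_eq hab']
      simp only [mul_assoc, inv_mul_cancel_left]
      exact mul_mem (intMonomial_truncate_mem x _ _) (inv_mem (intMonomial_truncate_mem x _ _))
    have h2 : a k' = b k' := sub_eq_zero.1 (hx.infinite_cyclic k' _ h1)
    rw [h2] at hab'
    have h3 := ih (mul_left_cancel hab')
    funext j
    have h4 := congrFun h3 j
    simp only [truncate] at h4 ⊢
    split_ifs with hj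
    · rcases hj.eq_or_lt with hj | hj
      · have : j = k' := Fin.ext hj.symm
        rw [this, h2]
      · rwa [if_pos (Nat.succ_le_of_lt hj), if_pos (Nat.succ_le_of_lt hj)] at h4
    · rfl

theorem bijective_intMonomial (hx : IsMalcevBasis x) : Function.Bijective (intMonomial x) := by
  refine ⟨fun a b hab => ?_, fun u => ?_⟩
  · have := hx.truncate_injective 0 a b
    simp only [truncate_zero] at this
    exact this hab
  · obtain ⟨a, ha⟩ := hx.exists_eq_truncate 0 u (hx.generates ▸ Subgroup.mem_top u)
    exact ⟨a, by rw [ha, truncate_zero]⟩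

/-- The vector of exponents of an element of `N` with respect to a Mal'cev basis. -/
noncomputable def coord (hx : IsMalcevBasis x) (u : N) : Fin h → ℤ :=
  (Equiv.ofBijective _ hx.bijective_intMonomial).symm u

variable (hx : IsMalcevBasis x)

theorem intMonomial_coord (u : N) : intMonomial x (hx.coord u) = u :=
  (Equiv.ofBijective _ hx.bijective_intMonomial).apply_symm_apply u

theorem coord_intMonomial (a : Fin h → ℤ) : hx.coord (intMonomial x a) = a :=
  (Equiv.ofBijective _ hx.bijective_intMonomial).symm_apply_apply a

theorem coord_one : hx.coord 1 = 0 := by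
  rw [← intMonomial_zero x, coord_intMonomial]

theorem coord_of_mem {i : ℕ} {u : N} (hu : u ∈ tailSubgroup x i) {j : Fin h} (hj : (j : ℕ) < i) :
    hx.coord u j = 0 := by
  obtain ⟨a, rfl⟩ := hx.exists_eq_truncate i u hu
  simp [coord_intMonomial, truncate, not_le.2 hj]

theorem truncate_coord_of_mem {i : ℕ} {u : N} (hu : u ∈ tailSubgroup x i) :
    truncate i (hx.coord u) = hx.coord u := by
  obtain ⟨a, rfl⟩ := hx.exists_eq_truncate i u hu
  rw [coord_intMonomial, truncate_truncate le_rfl]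

/-- The part `x_1 ^ a_1 ⋯ x_{i-1} ^ a_{i-1}` of an element `x ^ a` (indices start at `0`). -/
noncomputable def head (hx : IsMalcevBasis x) (i : ℕ) (u : N) : N :=
  intMonomial x (headVector i (hx.coord u))

/-- The part `x_i ^ a_i ⋯ x_h ^ a_h` of an element `x ^ a` (indices start at `0`). -/
noncomputable def rest (hx : IsMalcevBasis x) (i : ℕ) (u : N) : N :=
  intMonomial x (truncate i (hx.coord u))

theorem head_mul_rest (i : ℕ) (u : N) : hx.head i u * hx.rest i u = u := by
  rw [head, rest, ← intMonomial_split, intMonomial_coord]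

theorem rest_mem (hx : IsMalcevBasis x) (i : ℕ) (u : N) : hx.rest i u ∈ tailSubgroup x i :=
  intMonomial_truncate_mem x i _

theorem coord_head (i : ℕ) (u : N) : hx.coord (hx.head i u) = headVector i (hx.coord u) :=
  hx.coord_intMonomial _

theorem coord_rest (i : ℕ) (u : N) : hx.coord (hx.rest i u) = truncate i (hx.coord u) :=
  hx.coord_intMonomial _

theorem head_mem {k i : ℕ} {u : N} (hu : u ∈ tailSubgroup x k) :
    hx.head i u ∈ tailSubgroup x k := by
  refine intMonomial_mem_tailSubgroup x fun j hj => ?_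
  simp [headVector, hx.coord_of_mem hu hj]

theorem coord_head_mul (i : ℕ) (u : N) {m : N} (hm : m ∈ tailSubgroup x i) :
    hx.coord (hx.head i u * m) =
      fun j : Fin h => if (j : ℕ) < i then hx.coord u j else hx.coord m j := by
  obtain ⟨a, rfl⟩ := hx.exists_eq_truncate i m hm
  rw [head, intMonomial_head_mul_truncate, coord_intMonomial, coord_intMonomial]
  funext j
  split_ifs with hj
  · rfl
  · simp [truncate, not_lt.1 hj]

theorem mul_comm_mod (hx : IsMalcevBasis x) {i : ℕ} (u : N) {m : N} (hm : m ∈ tailSubgroup x i) :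
    ∃ r ∈ tailSubgroup x (i + 1), u⁻¹ * m * u = m * r := by
  refine ⟨m⁻¹ * u⁻¹ * m * u, ?_, by group⟩
  have := hx.central i (Subgroup.commutator_mem_commutator (inv_mem hm) (Subgroup.mem_top u⁻¹))
  simpa [commutatorElement_def] using this

theorem eq_zpow_mul_rest {i : Fin h} {m : N} (hm : m ∈ tailSubgroup x i) :
    m = x i ^ hx.coord m i * hx.rest (i + 1) m := by
  rw [rest, ← intMonomial_truncate, hx.truncate_coord_of_mem hm, intMonomial_coord]

theorem coord_zpow_mul (i : Fin h) (n : ℤ) {r : N} (hr : r ∈ tailSubgroup x (i + 1)) :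
    hx.coord (x i ^ n * r) = Function.update (hx.coord r) i n := by
  have h1 : x i ^ n * r = intMonomial x (Function.update (hx.coord r) i n) := by
    have h0 : truncate (i : ℕ) (Function.update (hx.coord r) i n) =
        Function.update (hx.coord r) i n := by
      funext j
      simp only [truncate, ite_eq_left_iff, not_le]
      intro hj
      rw [Function.update_of_ne (fun hji => by simp [hji] at hj), hx.coord_of_mem hr (by omega)]
    rw [← h0, intMonomial_truncate, Function.update_self]
    congr 1
    conv_lhs => rw [← hx.intMonomial_coord r, ← hx.truncate_coord_of_mem hr]
    congr 1
    funext j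
    simp only [truncate]
    split_ifs with hj
    · rw [Function.update_of_ne]
      rintro rfl
      omega
    · rfl
  rw [h1, coord_intMonomial]

theorem coord_mul_of_mem_right (i : Fin h) (u : N) {m : N} (hm : m ∈ tailSubgroup x i) :
    hx.coord (u * m) i = hx.coord u i + hx.coord m i := by
  have hu := hx.rest_mem i u
  have h1 : hx.coord (u * m) i = hx.coord (hx.rest i u * m) i := by
    conv_lhs => rw [← hx.head_mul_rest i u, mul_assoc]
    rw [hx.coord_head_mul i u (mul_mem hu hm)]
    simp
  have h2 : hx.coord (hx.rest i u) i = hx.coord u i := by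
    rw [coord_rest]
    simp [truncate]
  rw [h1, ← h2]
  obtain ⟨r, hr, hr'⟩ := hx.mul_comm_mod (i := i + 1) (x i ^ hx.coord m i)
    (hx.rest_mem (i + 1) (hx.rest i u))
  have h3 : hx.rest i u * m = x i ^ (hx.coord (hx.rest i u) i + hx.coord m i) *
      (hx.rest (i + 1) (hx.rest i u) * r * hx.rest (i + 1) m) := by
    conv_lhs => rw [hx.eq_zpow_mul_rest hu, hx.eq_zpow_mul_rest hm]
    rw [← hr', zpow_add]
    group
  rw [h3, hx.coord_zpow_mul, Function.update_self]
  exact mul_mem (mul_mem (hx.rest_mem _ _) (tailSubgroup_antitone x (by omega) hr))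
    (hx.rest_mem _ _)

theorem coord_conj_of_mem (i : Fin h) (u : N) {m : N} (hm : m ∈ tailSubgroup x i) :
    hx.coord (u⁻¹ * m * u) i = hx.coord m i := by
  obtain ⟨r, hr, hr'⟩ := hx.mul_comm_mod u hm
  rw [hr', hx.coord_mul_of_mem_right i m (tailSubgroup_antitone x (by omega) hr),
    hx.coord_of_mem hr (by omega), add_zero]

theorem conj_mem (hx : IsMalcevBasis x) (i : ℕ) (u : N) {m : N} (hm : m ∈ tailSubgroup x i) :
    u⁻¹ * m * u ∈ tailSubgroup x i := by
  simpa using (hx.tail_normal i).conj_mem m hm u⁻¹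

/-- The `i`-th coordinate of a product is additive up to a term depending only on the previous
coordinates of the factors, since `N_i / N_{i+1}` is central in `N / N_{i+1}`. -/
theorem coord_mul (i : Fin h) (u v : N) :
    hx.coord (u * v) i =
      hx.coord u i + hx.coord v i + hx.coord (hx.head i u * hx.head i v) i := by
  have h1 : u * v = hx.head i u * hx.head i v *
      ((hx.head i v)⁻¹ * hx.rest i u * hx.head i v) * hx.rest i v := by
    conv_lhs => rw [← hx.head_mul_rest i u, ← hx.head_mul_rest i v]
    group
  rw [h1, hx.coord_mul_of_mem_right i _ (hx.rest_mem i v),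
    hx.coord_mul_of_mem_right i _ (hx.conj_mem i _ (hx.rest_mem i u)),
    hx.coord_conj_of_mem i _ (hx.rest_mem i u), coord_rest, coord_rest]
  simp only [truncate, le_refl, if_true]
  ring

theorem coord_conj (i : Fin h) (u m : N) :
    hx.coord (u⁻¹ * m * u) i = hx.coord m i + hx.coord (u⁻¹ * hx.head i m * u) i := by
  have h1 : u⁻¹ * m * u = u⁻¹ * hx.head i m * u * (u⁻¹ * hx.rest i m * u) := by
    conv_lhs => rw [← hx.head_mul_rest i m]
    group
  rw [h1, hx.coord_mul_of_mem_right i _ (hx.conj_mem i _ (hx.rest_mem i m)),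
    hx.coord_conj_of_mem i _ (hx.rest_mem i m), coord_rest]
  simp only [truncate, le_refl, if_true]
  ring

end IsMalcevBasis

end Discrete

/-! ### Polynomial functions on `ℤ ^ σ` -/

/-- An integer valued function on `ℤ ^ σ` given by a polynomial with rational coefficients. -/
def IsPolyFun {σ : Type*} (F : (σ → ℤ) → ℤ) : Prop :=
  ∃ P : MvPolynomial σ ℚ, ∀ s, (F s : ℚ) = MvPolynomial.aeval (fun i => (s i : ℚ)) P

namespace IsPolyFun

variable {σ τ : Type*} {F G : (σ → ℤ) → ℤ}

theorem const (c : ℤ) : IsPolyFun fun _ : σ → ℤ => c :=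
  ⟨MvPolynomial.C (c : ℚ), fun s => by simp⟩

theorem proj (i : σ) : IsPolyFun fun s : σ → ℤ => s i :=
  ⟨MvPolynomial.X i, fun s => by simp⟩

theorem add (hF : IsPolyFun F) (hG : IsPolyFun G) : IsPolyFun fun s => F s + G s := by
  obtain ⟨P, hP⟩ := hF
  obtain ⟨Q, hQ⟩ := hG
  exact ⟨P + Q, fun s => by simp [hP, hQ]⟩

theorem comp {F : (τ → ℤ) → ℤ} (hF : IsPolyFun F) {G : τ → (σ → ℤ) → ℤ}
    (hG : ∀ j, IsPolyFun (G j)) : IsPolyFun fun s => F fun j => G j s := by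
  obtain ⟨P, hP⟩ := hF
  choose Q hQ using hG
  refine ⟨MvPolynomial.aeval Q P, fun s => ?_⟩
  rw [hP, ← AlgHom.comp_apply, MvPolynomial.comp_aeval]
  simp only [hQ]

end IsPolyFun

/-- Discrete antiderivative: every polynomial in `(X, W)` is the difference
`S(X, W + 1) - S(X, W)` of some polynomial `S` with `S(X, 0) = 0`. Monomials in `W` are summed with
the Bernoulli polynomials. -/
theorem MvPolynomial.exists_antidifference {σ : Type*} (P : MvPolynomial (σ ⊕ Unit) ℚ) :
    ∃ S : MvPolynomial (σ ⊕ Unit) ℚ, ∀ s : σ → ℚ,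
      MvPolynomial.aeval (Sum.elim s fun _ => (0 : ℚ)) S = 0 ∧
      ∀ w : ℚ, MvPolynomial.aeval (Sum.elim s fun _ => w + 1) S -
        MvPolynomial.aeval (Sum.elim s fun _ => w) S =
          MvPolynomial.aeval (Sum.elim s fun _ => w) P := by
  -- the antidifference of `A(X) W ^ n` is `A(X) (B_{n+1}(W) - B_{n+1}(0)) / (n + 1)`
  have key : ∀ (n : ℕ) (A : MvPolynomial σ ℚ), ∃ S : MvPolynomial (σ ⊕ Unit) ℚ, ∀ s : σ → ℚ,
      MvPolynomial.aeval (Sum.elim s fun _ => (0 : ℚ)) S = 0 ∧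
      ∀ w : ℚ, MvPolynomial.aeval (Sum.elim s fun _ => w + 1) S -
        MvPolynomial.aeval (Sum.elim s fun _ => w) S = MvPolynomial.aeval s A * w ^ n := by
    intro n A
    let B : Polynomial ℚ := Polynomial.C ((n + 1 : ℚ)⁻¹) *
      (Polynomial.bernoulli (n + 1) - Polynomial.C ((Polynomial.bernoulli (n + 1)).eval 0))
    have hB : ∀ (s : σ → ℚ) (w : ℚ), MvPolynomial.aeval (Sum.elim s fun _ => w)
        (MvPolynomial.rename Sum.inl A * Polynomial.aeval (MvPolynomial.X (Sum.inr ())) B) =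
        MvPolynomial.aeval s A * B.eval w := by
      intro s w
      rw [map_mul, MvPolynomial.aeval_rename, ← Polynomial.aeval_algHom_apply]
      simp [Function.comp_def, Polynomial.aeval_def]
    refine ⟨MvPolynomial.rename Sum.inl A * Polynomial.aeval (MvPolynomial.X (Sum.inr ())) B,
      fun s => ⟨?_, fun w => ?_⟩⟩
    · rw [hB]
      simp [B]
    · rw [hB, hB, ← mul_sub]
      congr 1
      have h1 := Polynomial.bernoulli_eval_one_add (n + 1) w
      have h2 : (n + 1 : ℚ) ≠ 0 := by positivity
      simp only [B, Polynomial.eval_mul, Polynomial.eval_C, Polynomial.eval_sub, add_comm w 1, h1]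
      field_simp
      push_cast
      simp
  -- for the induction on `P` a factor `A(X) W ^ n` is carried along
  have key' : ∀ (n : ℕ) (A : MvPolynomial σ ℚ), ∃ S : MvPolynomial (σ ⊕ Unit) ℚ,
      ∀ s : σ → ℚ, MvPolynomial.aeval (Sum.elim s fun _ => (0 : ℚ)) S = 0 ∧
      ∀ w : ℚ, MvPolynomial.aeval (Sum.elim s fun _ => w + 1) S -
        MvPolynomial.aeval (Sum.elim s fun _ => w) S =
          MvPolynomial.aeval s A * w ^ n * MvPolynomial.aeval (Sum.elim s fun _ => w) P := by
    induction P using MvPolynomial.induction_on with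
    | C c =>
      intro n A
      obtain ⟨S, hS⟩ := key n (A * MvPolynomial.C c)
      refine ⟨S, fun s => ⟨(hS s).1, fun w => ?_⟩⟩
      rw [(hS s).2]
      simp only [map_mul, MvPolynomial.aeval_C]
      ring
    | add P Q hP hQ =>
      intro n A
      obtain ⟨S, hS⟩ := hP n A
      obtain ⟨S', hS'⟩ := hQ n A
      refine ⟨S + S', fun s => ⟨?_, fun w => ?_⟩⟩
      · rw [map_add, (hS s).1, (hS' s).1, add_zero]
      · rw [map_add, map_add, map_add, mul_add, ← (hS s).2, ← (hS' s).2]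
        ring
    | mul_X P i hP =>
      intro n A
      cases i with
      | inl i =>
        obtain ⟨S, hS⟩ := hP n (A * MvPolynomial.X i)
        refine ⟨S, fun s => ⟨(hS s).1, fun w => ?_⟩⟩
        rw [(hS s).2]
        simp only [map_mul, MvPolynomial.aeval_X, Sum.elim_inl]
        ring
      | inr i =>
        obtain ⟨S, hS⟩ := hP (n + 1) A
        refine ⟨S, fun s => ⟨(hS s).1, fun w => ?_⟩⟩
        rw [(hS s).2]
        simp only [map_mul, MvPolynomial.aeval_X, Sum.elim_inr]
        ring
  simpa using key' 0 1

/-- A function on `ℤ ^ σ × ℤ` whose difference in the last variable is polynomial, and whose values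
at `0` are polynomial, is polynomial. -/
theorem IsPolyFun.of_difference {σ : Type*} {F : (σ → ℤ) → ℤ → ℤ} (h0 : IsPolyFun fun s => F s 0)
    (h1 : IsPolyFun fun s : σ ⊕ Unit → ℤ =>
      F (s ∘ Sum.inl) (s (Sum.inr ()) + 1) - F (s ∘ Sum.inl) (s (Sum.inr ()))) :
    IsPolyFun fun s : σ ⊕ Unit → ℤ => F (s ∘ Sum.inl) (s (Sum.inr ())) := by
  obtain ⟨A, hA⟩ := h0
  obtain ⟨P, hP⟩ := h1
  obtain ⟨S, hS⟩ := P.exists_antidifference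
  refine ⟨MvPolynomial.rename Sum.inl A + S, fun s => ?_⟩
  have hev : ∀ (s : σ → ℤ) (w : ℤ),
      (F s w : ℚ) = F s 0 + MvPolynomial.aeval (Sum.elim (fun i => (s i : ℚ)) fun _ => (w : ℚ)) S := by
    intro s w
    have hstep : ∀ w : ℤ, (F s (w + 1) : ℚ) - F s w =
        MvPolynomial.aeval (Sum.elim (fun i => (s i : ℚ)) fun _ => (w : ℚ) + 1) S -
        MvPolynomial.aeval (Sum.elim (fun i => (s i : ℚ)) fun _ => (w : ℚ)) S := by
      intro w
      rw [(hS _).2]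
      have := hP (Sum.elim s fun _ => w)
      push_cast at this
      simp only [Sum.elim_comp_inl, Sum.elim_inr] at this
      rw [this]
      congr 2
      funext i
      cases i <;> rfl
    induction w using Int.induction_on with
    | zero => simp [(hS _).1]
    | succ n ih =>
      have := hstep n
      push_cast at this ih ⊢
      linarith
    | pred n ih =>
      have := hstep (-n - 1)
      push_cast at this ih ⊢
      simp only [sub_add_cancel] at this
      linarith
  rw [hev, map_add, MvPolynomial.aeval_rename, hA]
  congr 2
  congr 1
  funext i
  cases i <;> rfl

/-! ### The coordinates of products and powers are polynomial -/

/-- A map `ℤ ^ σ → N` whose coordinates with respect to a Mal'cev basis are polynomial. -/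
def IsMalcevBasis.IsPolyMap {N : Type*} [Group N] {h : ℕ} {x : Fin h → N} (hx : IsMalcevBasis x)
    {σ : Type*} (F : (σ → ℤ) → N) : Prop :=
  ∀ i, IsPolyFun fun s => hx.coord (F s) i

namespace IsMalcevBasis

variable {N : Type*} [Group N] {h : ℕ} {x : Fin h → N}

/-- Products of polynomial maps with values in `⟨x_k, …, x_h⟩` are polynomial. -/
def PolyMul (hx : IsMalcevBasis x) (k : ℕ) : Prop :=
  ∀ (σ : Type) (F G : (σ → ℤ) → N), (∀ s, F s ∈ tailSubgroup x k) → (∀ s, G s ∈ tailSubgroup x k) →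
    hx.IsPolyMap F → hx.IsPolyMap G → hx.IsPolyMap fun s => F s * G s

variable (hx : IsMalcevBasis x)

theorem isPolyMap_const {σ : Type*} (u : N) : hx.IsPolyMap fun _ : σ → ℤ => u :=
  fun _ => IsPolyFun.const _

theorem IsPolyMap.comp {hx : IsMalcevBasis x} {σ τ : Type*} {F : (τ → ℤ) → N} (hF : hx.IsPolyMap F)
    {G : τ → (σ → ℤ) → ℤ} (hG : ∀ j, IsPolyFun (G j)) :
    hx.IsPolyMap fun s => F fun j => G j s :=
  fun i => (hF i).comp hG

theorem isPolyMap_head {σ : Type*} {F : (σ → ℤ) → N} (i : ℕ)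
    (hF : ∀ j : Fin h, (j : ℕ) < i → IsPolyFun fun s => hx.coord (F s) j) :
    hx.IsPolyMap fun s => hx.head i (F s) := by
  intro j
  simp only [coord_head, headVector]
  split_ifs with hj
  · exact hF j hj
  · exact IsPolyFun.const 0

theorem isPolyMap_rest {σ : Type*} {F : (σ → ℤ) → N} (i : ℕ) (hF : hx.IsPolyMap F) :
    hx.IsPolyMap fun s => hx.rest i (F s) := by
  intro j
  simp only [coord_rest, truncate]
  split_ifs with hj
  · exact hF j
  · exact IsPolyFun.const 0

/-- Powers of a polynomial map are polynomial: the `i`-th coordinate of `F(s) ^ (n + 1)` differs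
from that of `F(s) ^ n` by a polynomial in the previous coordinates. -/
theorem PolyMul.zpow {hx : IsMalcevBasis x} {k : ℕ} (hk : hx.PolyMul k) {σ : Type}
    {F : (σ → ℤ) → N} (hFk : ∀ s, F s ∈ tailSubgroup x k) (hF : hx.IsPolyMap F) :
    hx.IsPolyMap fun s : σ ⊕ Unit → ℤ => F (s ∘ Sum.inl) ^ s (Sum.inr ()) := by
  have hF' : hx.IsPolyMap fun s : σ ⊕ Unit → ℤ => F (s ∘ Sum.inl) :=
    hF.comp fun j => IsPolyFun.proj (Sum.inl j)
  intro i
  induction i using WellFoundedLT.induction with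
  | ind i ih =>
    refine IsPolyFun.of_difference (F := fun s n => hx.coord (F s ^ n) i) ?_ ?_
    · simpa using IsPolyFun.const _
    · have h1 : ∀ (n : ℤ) (u : N), hx.coord (u ^ (n + 1)) i - hx.coord (u ^ n) i =
          hx.coord u i + hx.coord (hx.head i (u ^ n) * hx.head i u) i := by
        intro n u
        rw [zpow_add_one, hx.coord_mul i]
        ring
      simp only [h1]
      have := hk _ _ _
        (fun s : σ ⊕ Unit → ℤ =>
          hx.head_mem (i := i) (zpow_mem (hFk (s ∘ Sum.inl)) (s (Sum.inr ()))))
        (fun s => hx.head_mem (i := i) (hFk (s ∘ Sum.inl)))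
        (hx.isPolyMap_head i fun j hj => ih j hj) (hx.isPolyMap_head i fun j _ => hF' j) i
      exact (hF' i).add this

theorem PolyMul.zpow' {hx : IsMalcevBasis x} {k : ℕ} (hk : hx.PolyMul k) {σ : Type}
    {F : (σ → ℤ) → N} (hFk : ∀ s, F s ∈ tailSubgroup x k) (hF : hx.IsPolyMap F)
    {w : (σ → ℤ) → ℤ} (hw : IsPolyFun w) : hx.IsPolyMap fun s => F s ^ w s :=
  (hk.zpow hFk hF).comp (G := fun j s => Sum.elim s (fun _ => w s) j) fun j => by
    cases j with
    | inl j => exact IsPolyFun.proj j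
    | inr j => exact hw

theorem PolyMul.listProd {hx : IsMalcevBasis x} {k : ℕ} (hk : hx.PolyMul k) {σ : Type} :
    ∀ {m : ℕ} (F : Fin m → (σ → ℤ) → N), (∀ j s, F j s ∈ tailSubgroup x k) →
      (∀ j, hx.IsPolyMap (F j)) → hx.IsPolyMap fun s => (List.ofFn fun j => F j s).prod
  | 0, _, _, _ => by simpa using hx.isPolyMap_const 1
  | m + 1, F, hFk, hF => by
    simp only [List.ofFn_succ, List.prod_cons]
    refine hk _ _ _ (hFk 0) (fun s => Subgroup.list_prod_mem _ fun g hg => ?_) (hF 0)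
      (hk.listProd (fun j => F j.succ) (fun j => hFk j.succ) fun j => hF j.succ)
    obtain ⟨j, rfl⟩ := List.mem_ofFn.1 hg
    exact hFk _ _

/-- Conjugation by a fixed element is polynomial: the conjugate of `x ^ a` is the product of the
powers `(u⁻¹ x_j u) ^ a_j`. -/
theorem PolyMul.conj {hx : IsMalcevBasis x} {k : ℕ} (hk : hx.PolyMul k) {σ : Type}
    {F : (σ → ℤ) → N} (hFk : ∀ s, F s ∈ tailSubgroup x k) (hF : hx.IsPolyMap F) (u : N) :
    hx.IsPolyMap fun s => u⁻¹ * F s * u := by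
  have h1 : ∀ s, u⁻¹ * F s * u =
      (List.ofFn fun j => (u⁻¹ * x j * u) ^ hx.coord (F s) j).prod := by
    intro s
    conv_lhs => rw [← hx.intMonomial_coord (F s), intMonomial]
    have h2 := map_list_prod (MulAut.conj u⁻¹) (List.ofFn fun i => x i ^ hx.coord (F s) i)
    simp only [MulAut.conj_apply, inv_inv, List.map_ofFn, Function.comp_def] at h2
    rw [h2]
    congr 2
    funext j
    simpa using (conj_zpow (i := hx.coord (F s) j) (a := u⁻¹) (b := x j)).symm
  rw [funext h1]
  refine hk.listProd _ (fun j s => ?_) fun j => ?_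
  · by_cases hj : (j : ℕ) < k
    · simp [hx.coord_of_mem (hFk s) hj]
    · exact zpow_mem (hx.conj_mem k u (mem_tailSubgroup x (not_lt.1 hj))) _
  · by_cases hj : (j : ℕ) < k
    · simpa [hx.coord_of_mem (hFk _) hj] using hx.isPolyMap_const 1
    · exact hk.zpow' (fun _ => hx.conj_mem k u (mem_tailSubgroup x (not_lt.1 hj)))
        (hx.isPolyMap_const _) (hF j)

/-- Conjugation by a variable power `u ^ n` is polynomial in `n`: as `u` acts trivially on
`N_i / N_{i+1}`, the `i`-th coordinate of the `(n + 1)`-st conjugate differs from that of the `n`-th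
by a polynomial in the previous coordinates. -/
theorem PolyMul.conj_zpow {hx : IsMalcevBasis x} {k : ℕ} (hk : hx.PolyMul k) {σ : Type}
    {F : (σ → ℤ) → N} (hFk : ∀ s, F s ∈ tailSubgroup x k) (hF : hx.IsPolyMap F) (u : N) :
    hx.IsPolyMap fun s : σ ⊕ Unit → ℤ =>
      (u ^ s (Sum.inr ()))⁻¹ * F (s ∘ Sum.inl) * u ^ s (Sum.inr ()) := by
  intro i
  induction i using WellFoundedLT.induction with
  | ind i ih =>
    refine IsPolyFun.of_difference
      (F := fun s n => hx.coord ((u ^ n)⁻¹ * F s * u ^ n) i) ?_ ?_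
    · simpa using hF i
    · have h1 : ∀ (n : ℤ) (m : N), hx.coord ((u ^ (n + 1))⁻¹ * m * u ^ (n + 1)) i -
          hx.coord ((u ^ n)⁻¹ * m * u ^ n) i =
          hx.coord (u⁻¹ * hx.head i ((u ^ n)⁻¹ * m * u ^ n) * u) i := by
        intro n m
        have : (u ^ (n + 1))⁻¹ * m * u ^ (n + 1) = u⁻¹ * ((u ^ n)⁻¹ * m * u ^ n) * u := by
          rw [zpow_add_one]
          group
        rw [this, hx.coord_conj i u, add_sub_cancel_left]
      simp only [h1]
      exact hk.conj (fun s => hx.head_mem (hx.conj_mem k _ (hFk (s ∘ Sum.inl))))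
        (hx.isPolyMap_head i fun j hj => ih j hj) u i

theorem isPolyMap_zpow_mul {σ : Type*} (i : Fin h) {n : (σ → ℤ) → ℤ} {F : (σ → ℤ) → N}
    (hn : IsPolyFun n) (hF : hx.IsPolyMap F) (hFi : ∀ s, F s ∈ tailSubgroup x (i + 1)) :
    hx.IsPolyMap fun s => x i ^ n s * F s := by
  intro j
  simp only [hx.coord_zpow_mul i _ (hFi _), Function.update_apply]
  split_ifs
  · exact hn
  · exact hF j

/-- Products are polynomial, by downward induction on `k`: write `F = x_k ^ n m`, `G = x_k ^ n' m'`
with `m`, `m'` in `⟨x_{k+1}, …, x_h⟩`; then `F G = x_k ^ (n + n') (x_k ^ (-n') m x_k ^ n') m'`. -/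
theorem polyMul (k : ℕ) : hx.PolyMul k := by
  rcases le_total h k with hk | hk
  · intro σ F G hF hG _ _
    simp only [tailSubgroup_of_le x hk, Subgroup.mem_bot] at hF hG
    simpa [hF, hG] using hx.isPolyMap_const 1
  induction hk using Nat.decreasingInduction with
  | self =>
    intro σ F G hF hG _ _
    simp only [tailSubgroup_of_le x le_rfl, Subgroup.mem_bot] at hF hG
    simpa [hF, hG] using hx.isPolyMap_const 1
  | of_succ k hk ih =>
    intro σ F G hFk hGk hF hG
    let i : Fin h := ⟨k, hk⟩
    have h1 : ∀ s, F s * G s = x i ^ (hx.coord (F s) i + hx.coord (G s) i) *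
        ((x i ^ hx.coord (G s) i)⁻¹ * hx.rest (k + 1) (F s) * x i ^ hx.coord (G s) i *
          hx.rest (k + 1) (G s)) := by
      intro s
      conv_lhs => rw [hx.eq_zpow_mul_rest (i := i) (hFk s), hx.eq_zpow_mul_rest (i := i) (hGk s)]
      rw [zpow_add]
      group
      rfl
    rw [funext h1]
    have h2 : hx.IsPolyMap fun s =>
        (x i ^ hx.coord (G s) i)⁻¹ * hx.rest (k + 1) (F s) * x i ^ hx.coord (G s) i :=
      (ih.conj_zpow (fun s => hx.rest_mem (k + 1) (F s)) (hx.isPolyMap_rest _ hF) (x i)).comp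
        (G := fun j s => Sum.elim s (fun _ => hx.coord (G s) i) j) fun j => by
          cases j with
          | inl j => exact IsPolyFun.proj j
          | inr j => exact hG i
    have h3 := fun s => hx.rest_mem (k + 1) (F s)
    have h4 := fun s => hx.rest_mem (k + 1) (G s)
    exact hx.isPolyMap_zpow_mul i ((hF i).add (hG i))
      (ih _ _ _ (fun s => hx.conj_mem _ _ (h3 s)) h4 h2 (hx.isPolyMap_rest _ hG))
      fun s => mul_mem (hx.conj_mem _ _ (h3 s)) (h4 s)

theorem exists_isMulPolynomials (hx : IsMalcevBasis x) : ∃ f : Fin h → MvPolynomial (Fin h ⊕ Fin h) ℚ,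
    IsMulPolynomials x f := by
  have h1 : hx.IsPolyMap fun s : Fin h ⊕ Fin h → ℤ =>
      intMonomial x (s ∘ Sum.inl) * intMonomial x (s ∘ Sum.inr) := by
    refine hx.polyMul 0 _ _ _ (fun s => ?_) (fun s => ?_) (fun i => ?_) fun i => ?_
    · simp [hx.generates]
    · simp [hx.generates]
    · simpa only [coord_intMonomial, Function.comp_apply] using IsPolyFun.proj (Sum.inl i)
    · simpa only [coord_intMonomial, Function.comp_apply] using IsPolyFun.proj (Sum.inr i)
  choose f hf using h1
  refine ⟨f, fun a b => ⟨_, ?_, (hx.intMonomial_coord _).symm⟩⟩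
  funext i
  have := hf i (Sum.elim a b)
  simp only [Sum.elim_comp_inl, Sum.elim_comp_inr] at this
  rw [this, evalMul]
  congr 2
  funext j
  cases j <;> rfl

theorem exists_isPowPolynomials (hx : IsMalcevBasis x) : ∃ g : Fin h → MvPolynomial (Fin h ⊕ Unit) ℚ,
    IsPowPolynomials x g := by
  have h1 : hx.IsPolyMap fun s : Fin h ⊕ Unit → ℤ =>
      intMonomial x (s ∘ Sum.inl) ^ s (Sum.inr ()) := by
    refine (hx.polyMul 0).zpow (F := intMonomial x) (fun s => ?_) fun i => ?_
    · simp [hx.generates]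
    · simpa only [coord_intMonomial] using IsPolyFun.proj i
  choose g hg using h1
  refine ⟨g, fun a w => ⟨_, ?_, (hx.intMonomial_coord _).symm⟩⟩
  funext i
  have := hg i (Sum.elim a fun _ => w)
  simp only [Sum.elim_comp_inl, Sum.elim_inr] at this
  rw [this, evalPow]
  congr 2
  funext j
  cases j <;> rfl

end IsMalcevBasis

/-! ### The topology of the pro-`p` completion -/

namespace ProPCompletion

variable {p : ℕ} {N : Type*} [Group N]

theorem isLocallyConstant_apply (K : PIndexNormal p N) :
    IsLocallyConstant fun g : ProPCompletion p N => g.1 K := by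
  intro s
  have h1 : ProPCompletion.instTopologicalSpace p N ≤ TopologicalSpace.induced
      (fun g : ProPCompletion p N => (g : ∀ K : PIndexNormal p N, N ⧸ K.toSubgroup) K) ⊥ :=
    iInf_le _ K
  exact h1 _ ⟨s, trivial, rfl⟩

theorem continuous_of_isLocallyConstant {X : Type*} [TopologicalSpace X]
    {F : X → ProPCompletion p N} (hF : ∀ K, IsLocallyConstant fun y => (F y).1 K) :
    Continuous F := by
  refine continuous_iInf_rng.2 fun K => ?_
  let : TopologicalSpace (N ⧸ K.toSubgroup) := ⊥
  exact continuous_induced_rng.2 (hF K).continuous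

theorem isOpen_apply_eq (K : PIndexNormal p N) (q : N ⧸ K.toSubgroup) :
    IsOpen {g : ProPCompletion p N | g.1 K = q} :=
  isLocallyConstant_apply K {q}

instance instIsTopologicalGroup : IsTopologicalGroup (ProPCompletion p N) where
  continuous_mul := continuous_of_isLocallyConstant fun K => by
    refine (IsLocallyConstant.iff_eventually_eq _).2 fun q => ?_
    have h1 := (isLocallyConstant_apply K).comp_continuous
      (continuous_fst (X := ProPCompletion p N) (Y := ProPCompletion p N))
    have h2 := (isLocallyConstant_apply K).comp_continuous
      (continuous_snd (X := ProPCompletion p N) (Y := ProPCompletion p N))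
    filter_upwards [h1.eventually_eq q, h2.eventually_eq q] with r hr1 hr2
    exact congrArg₂ (· * ·) hr1 hr2
  continuous_inv := continuous_of_isLocallyConstant fun K =>
    (isLocallyConstant_apply K).comp (·⁻¹)

instance instT2Space : T2Space (ProPCompletion p N) := by
  refine ⟨fun g g' hg => ?_⟩
  obtain ⟨K, hK⟩ : ∃ K, g.1 K ≠ g'.1 K := by
    by_contra! hc
    exact hg (Subtype.ext (funext hc))
  refine ⟨_, _, isOpen_apply_eq K (g.1 K), isOpen_apply_eq K (g'.1 K), rfl, rfl, ?_⟩
  exact Set.disjoint_left.2 fun u hu hu' => hK (hu.symm.trans hu')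

end ProPCompletion

/-- The intersection of two normal subgroups of `p`-power index. -/
def PIndexNormal.inf {p : ℕ} [hp : Fact p.Prime] {N : Type*} [Group N] (K L : PIndexNormal p N) :
    PIndexNormal p N where
  toSubgroup := K.toSubgroup ⊓ L.toSubgroup
  normal := inferInstance
  index_eq := by
    obtain ⟨m, hm⟩ := K.index_eq
    obtain ⟨n, hn⟩ := L.index_eq
    have h1 := Subgroup.relIndex_mul_index
      (inf_le_right : K.toSubgroup ⊓ L.toSubgroup ≤ L.toSubgroup)
    rw [Subgroup.inf_relIndex_right] at h1
    have h2 := Subgroup.relIndex_dvd_index_of_normal K.toSubgroup L.toSubgroup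
    rw [hm] at h2
    obtain ⟨k, -, hk⟩ := (Nat.dvd_prime_pow hp.out).1 h2
    exact ⟨k + n, by rw [← h1, hk, hn, pow_add]⟩

section PadicPow

variable {p : ℕ} [hp : Fact p.Prime] {N : Type*} [Group N]

/-- In `N ⧸ K` the `p`-adic power `g ^ a` may be computed with any integer close to `a`. -/
theorem padicPow_apply (g : ProPCompletion p N) (K : PIndexNormal p N) {a : ℤ_[p]} {n : ℤ}
    (ha : (p : ℤ_[p]) ^ padicValNat p K.toSubgroup.index ∣ a - n) :
    (padicPow g a).1 K = g.1 K ^ n := by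
  set m := padicValNat p K.toSubgroup.index with hm
  have h1 : (p : ℤ_[p]) ^ m ∣ ((a.appr m : ℤ) - n : ℤ) := by
    have h2 := Ideal.mem_span_singleton.1 (PadicInt.appr_spec m a)
    have h3 := dvd_sub ha h2
    push_cast
    convert h3 using 1
    ring
  rw [PadicInt.pow_p_dvd_int_iff] at h1
  obtain ⟨c, hc⟩ := h1
  have h4 : (padicPow g a).1 K = g.1 K ^ (a.appr m : ℤ) := (zpow_natCast _ _).symm
  have h5 : g.1 K ^ ((p : ℤ) ^ m) = 1 := by
    exact_mod_cast K.pow_eq_one (g.1 K)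
  have h6 : (a.appr m : ℤ) = n + (p : ℤ) ^ m * c := by linarith
  rw [h4, h6, zpow_add, zpow_mul, h5, one_zpow, mul_one]

theorem padicPow_intCast (g : ProPCompletion p N) (n : ℤ) : padicPow g (n : ℤ_[p]) = g ^ n := by
  refine Subtype.ext (funext fun K => ?_)
  rw [padicPow_apply g K (n := n) (by simp)]
  rfl

theorem padicPow_zero (g : ProPCompletion p N) : padicPow g (0 : ℤ_[p]) = 1 := by
  simpa using padicPow_intCast g 0

theorem padicPow_one (g : ProPCompletion p N) : padicPow g (1 : ℤ_[p]) = g := by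
  simpa using padicPow_intCast g 1

theorem padicPow_neg_one (g : ProPCompletion p N) : padicPow g (-1 : ℤ_[p]) = g⁻¹ := by
  simpa using padicPow_intCast g (-1)

theorem PadicInt.eventually_pow_dvd_sub (a : ℤ_[p]) (m : ℕ) :
    ∀ᶠ b in nhds a, (p : ℤ_[p]) ^ m ∣ b - a := by
  have hpos : (0 : ℝ) < (p : ℝ) ^ (-(m : ℤ)) := by
    have := hp.out.pos
    positivity
  filter_upwards [Metric.closedBall_mem_nhds a hpos] with b hb
  rwa [← Ideal.mem_span_singleton, ← PadicInt.norm_le_pow_iff_mem_span_pow, ← dist_eq_norm]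

theorem continuous_padicPow :
    Continuous fun q : ProPCompletion p N × ℤ_[p] => padicPow q.1 q.2 := by
  refine ProPCompletion.continuous_of_isLocallyConstant fun K => ?_
  refine (IsLocallyConstant.iff_eventually_eq _).2 fun q => ?_
  have h1 := (ProPCompletion.isLocallyConstant_apply K).comp_continuous
    (continuous_fst (X := ProPCompletion p N) (Y := ℤ_[p]))
  have h2 := continuous_snd.tendsto q |>.eventually
    (PadicInt.eventually_pow_dvd_sub q.2 (padicValNat p K.toSubgroup.index))
  have h3 := Ideal.mem_span_singleton.1
    (PadicInt.appr_spec (padicValNat p K.toSubgroup.index) q.2)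
  filter_upwards [h1.eventually_eq q, h2] with r hr1 hr2
  have h4 := dvd_add hr2 h3
  rw [sub_add_sub_cancel] at h4
  rw [padicPow_apply q.1 K (n := (PadicInt.appr q.2 (padicValNat p K.toSubgroup.index) : ℕ))
    (by exact_mod_cast h3),
    padicPow_apply r.1 K (n := (PadicInt.appr q.2 (padicValNat p K.toSubgroup.index) : ℕ))
    (by exact_mod_cast h4)]
  exact congrArg (· ^ _) hr1

theorem continuous_list_prod_ofFn {X G : Type*} [TopologicalSpace X] [TopologicalSpace G] [Monoid G]
    [ContinuousMul G] {m : ℕ} {F : Fin m → X → G} (hF : ∀ i, Continuous (F i)) :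
    Continuous fun y => (List.ofFn fun i => F i y).prod := by
  simp only [List.ofFn_eq_map]
  exact continuous_list_prod _ fun i _ => hF i

theorem continuous_padicMonomial {m : ℕ} (y : Fin m → ProPCompletion p N) :
    Continuous (padicMonomial y) :=
  continuous_list_prod_ofFn fun i =>
    continuous_padicPow.comp (continuous_const.prodMk (continuous_apply i))

variable {h : ℕ} (x : Fin h → N)

theorem continuous_xPow : Continuous (xPow (p := p) x) :=
  continuous_padicMonomial _

theorem xPow_intCast (a : Fin h → ℤ) :
    xPow x (fun i => (a i : ℤ_[p])) = toProP p (intMonomial x a) := by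
  simp only [xPow, padicMonomial, padicPow_intCast, intMonomial, map_list_prod, List.map_ofFn,
    Function.comp_def, map_zpow]

theorem xPow_apply (K : PIndexNormal p N) {a : Fin h → ℤ_[p]} {n : Fin h → ℤ}
    (ha : ∀ i, (p : ℤ_[p]) ^ padicValNat p K.toSubgroup.index ∣ a i - n i) :
    (xPow x a).1 K = QuotientGroup.mk (intMonomial x n) := by
  have h1 : (QuotientGroup.mk (intMonomial x n) : N ⧸ K.toSubgroup) =
      (toProP p (intMonomial x n)).1 K := rfl
  have h2 : ∀ g : ProPCompletion p N, g.1 K =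
    ((Pi.evalMonoidHom _ K).comp (compatibleFamilies p N).subtype) g := fun _ => rfl
  rw [h1, ← xPow_intCast, h2, h2, xPow, xPow, padicMonomial, padicMonomial, map_list_prod,
    map_list_prod, List.map_ofFn, List.map_ofFn]
  congr 2
  funext i
  simp only [Function.comp_apply, ← h2, padicPow_apply _ K (ha i), padicPow_intCast]
  rfl

end PadicPow

/-! ### Parametrisation of the pro-`p` completion by `ℤ_p ^ h` -/

section Congruence

variable {N : Type*} [Group N] {h : ℕ} {x : Fin h → N}

theorem PadicInt.continuous_aeval {p : ℕ} [Fact p.Prime] {σ : Type*} (P : MvPolynomial σ ℚ) :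
    Continuous fun a : σ → ℤ_[p] => MvPolynomial.aeval (fun i => (a i : ℚ_[p])) P := by
  have h1 : ∀ a : σ → ℤ_[p], MvPolynomial.aeval (fun i => (a i : ℚ_[p])) P =
      MvPolynomial.eval (fun i => (a i : ℚ_[p])) (MvPolynomial.map (algebraMap ℚ ℚ_[p]) P) := by
    intro a
    rw [MvPolynomial.eval_map]
    rfl
  simp only [h1]
  exact (MvPolynomial.continuous_eval _).comp
    (continuous_pi fun i => continuous_subtype_val.comp (continuous_apply i))

theorem PadicInt.aeval_intCast {p : ℕ} [Fact p.Prime] {σ : Type*} (P : MvPolynomial σ ℚ)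
    (s : σ → ℤ) : MvPolynomial.aeval (fun i => (((s i : ℤ) : ℤ_[p]) : ℚ_[p])) P =
      ((MvPolynomial.aeval (fun i => (s i : ℚ)) P : ℚ) : ℚ_[p]) := by
  have h1 := MvPolynomial.aeval_algebraMap_apply ℚ_[p] (fun i => (s i : ℚ)) P
  rw [eq_ratCast] at h1
  rw [← h1]
  congr 2

/-- An integer valued polynomial may have denominators, but it is uniformly continuous on the compact
space `ℤ_p ^ σ`, so its values modulo `p ^ m` are periodic. -/
theorem IsPolyFun.exists_modulus {σ : Type*} [Finite σ] {F : (σ → ℤ) → ℤ} (hF : IsPolyFun F)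
    (p : ℕ) [hp : Fact p.Prime] (m : ℕ) : ∃ M : ℕ, ∀ s s' : σ → ℤ,
      (∀ i, (p : ℤ) ^ M ∣ s i - s' i) → (p : ℤ) ^ m ∣ F s - F s' := by
  have := Fintype.ofFinite σ
  obtain ⟨P, hP⟩ := hF
  have h1 := CompactSpace.uniformContinuous_of_continuous (PadicInt.continuous_aeval (p := p) P)
  have hp0 : (0 : ℝ) < p := by exact_mod_cast hp.out.pos
  obtain ⟨δ, hδ, hd⟩ := Metric.uniformContinuous_iff.1 h1 ((p : ℝ) ^ (-(m : ℤ))) (by positivity)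
  obtain ⟨M, hM⟩ := PadicInt.exists_pow_neg_lt p hδ
  refine ⟨M, fun s s' hs => ?_⟩
  have h2 := hd (a := fun i => ((s i : ℤ) : ℤ_[p])) (b := fun i => ((s' i : ℤ) : ℤ_[p])) <|
    (dist_pi_lt_iff hδ).2 fun i => by
      rw [dist_eq_norm, ← Int.cast_sub]
      exact (PadicInt.norm_int_le_pow_iff_dvd.2 (hs i)).trans_lt hM
  rw [PadicInt.aeval_intCast, PadicInt.aeval_intCast, ← hP, ← hP, dist_eq_norm] at h2
  rw [← PadicInt.norm_int_le_pow_iff_dvd (p := p), PadicInt.norm_def]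
  push_cast at h2 ⊢
  exact h2.le

/-- The normal subgroup of the elements `y` of `N` for which `u y w` and `u w` have the same
coordinates modulo `p ^ m`, for all `u` and `w`. -/
def IsMalcevBasis.congruenceSubgroup (hx : IsMalcevBasis x) (p m : ℕ) : Subgroup N where
  carrier := {y | ∀ u w i, (p : ℤ) ^ m ∣ hx.coord (u * y * w) i - hx.coord (u * w) i}
  one_mem' u w i := by simp
  mul_mem' {y y'} hy hy' u w i := by
    have h1 := dvd_add (hy u (y' * w) i) (hy' u w i)
    simpa [mul_assoc] using h1
  inv_mem' {y} hy u w i := by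
    have h1 := hy u (y⁻¹ * w) i
    rw [dvd_sub_comm]
    simpa [mul_assoc] using h1

namespace IsMalcevBasis

theorem congruenceSubgroup_normal (hx : IsMalcevBasis x) (p m : ℕ) :
    (hx.congruenceSubgroup p m).Normal := by
  refine ⟨fun y hy v u w i => ?_⟩
  simpa [mul_assoc] using hy (u * v) (v⁻¹ * w) i

/-- The coordinates of `u y ^ e w` modulo `p ^ m` depend only on `y` and `e` modulo some `p ^ M`,
uniformly in `u` and `w`. -/
theorem exists_modulus (hx : IsMalcevBasis x) (p : ℕ) [Fact p.Prime] (m : ℕ) :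
    ∃ M : ℕ, ∀ (u w y y' : N) (e e' : ℤ), (∀ i, (p : ℤ) ^ M ∣ hx.coord y i - hx.coord y' i) →
      (p : ℤ) ^ M ∣ e - e' →
      ∀ i, (p : ℤ) ^ m ∣ hx.coord (u * y ^ e * w) i - hx.coord (u * y' ^ e' * w) i := by
  have hmem : ∀ u : N, u ∈ tailSubgroup x 0 := fun u => by simp [hx.generates]
  have hproj : ∀ {σ : Type} (φ : Fin h → σ), hx.IsPolyMap fun s : σ → ℤ =>
      intMonomial x fun i => s (φ i) := fun φ i => by
    simpa only [coord_intMonomial] using IsPolyFun.proj (φ i)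
  have hpow : hx.IsPolyMap fun s : (Fin h ⊕ Fin h) ⊕ (Fin h ⊕ Unit) → ℤ =>
      (intMonomial x fun i => s (Sum.inl (Sum.inl i))) *
        (intMonomial x fun i => s (Sum.inr (Sum.inl i))) ^ s (Sum.inr (Sum.inr ())) *
        (intMonomial x fun i => s (Sum.inl (Sum.inr i))) := by
    refine hx.polyMul 0 _ _ _ (fun _ => hmem _) (fun _ => hmem _)
      (hx.polyMul 0 _ _ _ (fun _ => hmem _) (fun _ => hmem _) (hproj _) ?_) (hproj _)
    exact (hx.polyMul 0).zpow' (fun _ => hmem _) (hproj _) (IsPolyFun.proj _)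
  choose M hM using fun i => (hpow i).exists_modulus p m
  refine ⟨Finset.univ.sup M, fun u w y y' e e' hy he i => ?_⟩
  have h1 := hM i
    (Sum.elim (Sum.elim (hx.coord u) (hx.coord w)) (Sum.elim (hx.coord y) fun _ => e))
    (Sum.elim (Sum.elim (hx.coord u) (hx.coord w)) (Sum.elim (hx.coord y') fun _ => e')) ?_
  · simpa only [Sum.elim_inl, Sum.elim_inr, intMonomial_coord] using h1
  · have h2 : (p : ℤ) ^ M i ∣ (p : ℤ) ^ Finset.univ.sup M :=
      pow_dvd_pow _ (Finset.le_sup (Finset.mem_univ i))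
    rintro ((j | j) | (j | j))
    · simp
    · simp
    · exact h2.trans (hy j)
    · exact h2.trans he

/-- The congruence subgroup as a normal subgroup of `p`-power index: the index is finite since
multiplication is polynomial, and a power of `p` since powers are polynomial in the exponent. -/
def congruencePIndexNormal (hx : IsMalcevBasis x) (p : ℕ) [hp : Fact p.Prime] (m : ℕ) :
    PIndexNormal p N where
  toSubgroup := hx.congruenceSubgroup p m
  normal := hx.congruenceSubgroup_normal p m
  index_eq := by
    have := hx.congruenceSubgroup_normal p m
    obtain ⟨M, hM⟩ := hx.exists_modulus p m
    have : NeZero (p ^ M) := ⟨pow_ne_zero _ hp.out.ne_zero⟩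
    have hfin : Finite (N ⧸ hx.congruenceSubgroup p m) := by
      refine Finite.of_injective
        (fun q i => ((hx.coord q.out i : ℤ) : ZMod (p ^ M)) : _ → Fin h → ZMod (p ^ M)) ?_
      intro q q' hq
      rw [← q.out_eq, ← q'.out_eq]
      refine QuotientGroup.eq.2 fun u w i => ?_
      have h1 := hM (u * q.out⁻¹) w q'.out q.out 1 1 (fun i => ?_) (by simp) i
      · simpa [mul_assoc] using h1
      · have h2 := congrFun hq i
        simp only [ZMod.intCast_eq_intCast_iff_dvd_sub] at h2
        exact_mod_cast h2
    have hpg : IsPGroup p (N ⧸ hx.congruenceSubgroup p m) := by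
      refine fun q => ⟨M, ?_⟩
      induction q using QuotientGroup.induction_on with
      | H y =>
        rw [← QuotientGroup.mk_pow, QuotientGroup.eq_one_iff]
        intro u w i
        have h1 := hM u w y y ((p : ℤ) ^ M) 0 (by simp) (by simp) i
        simp only [zpow_zero, mul_one] at h1
        exact_mod_cast h1
    obtain ⟨n, hn⟩ := IsPGroup.iff_card.1 hpg
    exact ⟨n, by rw [Subgroup.index_eq_card, hn]⟩

variable (p : ℕ) [hp : Fact p.Prime]

/-- If `x ^ a = x ^ b`, then integral approximations of `a` and `b` have the same class modulo the
congruence subgroup, hence agree modulo `p ^ m`. -/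
theorem xPow_injective (hx : IsMalcevBasis x) : Function.Injective (xPow (p := p) x) := by
  intro a b hab
  funext i
  refine PadicInt.ext_of_toZModPow.1 fun m => ?_
  set K := hx.congruencePIndexNormal p m
  set L := max m (padicValNat p K.toSubgroup.index)
  have hdvd : ∀ (c : ℤ_[p]) {l : ℕ}, l ≤ L → (p : ℤ_[p]) ^ l ∣ c - ((c.appr L : ℤ) : ℤ_[p]) := by
    intro c l hl
    have h2 := Ideal.mem_span_singleton.1 (PadicInt.appr_spec L c)
    exact (pow_dvd_pow _ hl).trans (by exact_mod_cast h2)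
  have h1 : (xPow x a).1 K = (xPow x b).1 K := by rw [hab]
  rw [xPow_apply x K fun i => hdvd (a i) (le_max_right _ _),
    xPow_apply x K fun i => hdvd (b i) (le_max_right _ _)] at h1
  have h2 := QuotientGroup.eq.1 h1 (intMonomial x fun i => (a i).appr L) 1 i
  simp only [mul_inv_cancel_left, mul_one, coord_intMonomial] at h2
  rw [← PadicInt.pow_p_dvd_int_iff] at h2
  have h3 := dvd_sub (dvd_sub (hdvd (a i) (le_max_left _ _)) (hdvd (b i) (le_max_left _ _))) h2
  rw [← sub_eq_zero, ← map_sub, ← RingHom.mem_ker, PadicInt.ker_toZModPow,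
    Ideal.mem_span_singleton]
  push_cast at h3
  convert h3 using 1
  ring

/-- The exponents `a` for which `x ^ a` agrees with `g` in `N ⧸ K` form a directed family of nonempty
compact sets. -/
theorem xPow_surjective (hx : IsMalcevBasis x) : Function.Surjective (xPow (p := p) x) := by
  intro g
  have h1 : (⋂ K : PIndexNormal p N, {a | (xPow x a).1 K = g.1 K}).Nonempty := by
    have : Nonempty (PIndexNormal p N) := ⟨hx.congruencePIndexNormal p 0⟩
    have hclosed : ∀ K : PIndexNormal p N, IsClosed {a | (xPow x a).1 K = g.1 K} := fun K =>
      (((ProPCompletion.isLocallyConstant_apply K).isClosed_fiber (g.1 K)).preimage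
        (continuous_xPow x))
    refine IsCompact.nonempty_iInter_of_directed_nonempty_isCompact_isClosed _ ?_ ?_
      (fun K => (hclosed K).isCompact) hclosed
    · intro K L
      refine ⟨K.inf L, fun a ha => ?_, fun a ha => ?_⟩
      · have h2 := congrArg (QuotientGroup.map (K.inf L).toSubgroup K.toSubgroup (MonoidHom.id N)
          inf_le_left) ha
        exact ((xPow x a).2 _ K _).symm.trans (h2.trans (g.2 _ K _))
      · have h2 := congrArg (QuotientGroup.map (K.inf L).toSubgroup L.toSubgroup (MonoidHom.id N)
          inf_le_right) ha
        exact ((xPow x a).2 _ L _).symm.trans (h2.trans (g.2 _ L _))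
    · intro K
      obtain ⟨n, hn⟩ := QuotientGroup.mk_surjective (g.1 K)
      refine ⟨fun i => (hx.coord n i : ℤ_[p]), ?_⟩
      change (xPow x fun i => (hx.coord n i : ℤ_[p])).1 K = g.1 K
      rw [xPow_intCast, intMonomial_coord, ← hn]
      rfl
  obtain ⟨a, ha⟩ := h1
  exact ⟨a, Subtype.ext (funext fun K => Set.mem_iInter.1 ha K)⟩

/-- The homeomorphism `a ↦ x ^ a` from `ℤ_p ^ h` to `N_p`. -/
noncomputable def xPowHomeo (hx : IsMalcevBasis x) : (Fin h → ℤ_[p]) ≃ₜ ProPCompletion p N :=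
  Continuous.homeoOfEquivCompactToT2
    (f := Equiv.ofBijective _ ⟨hx.xPow_injective p, hx.xPow_surjective p⟩) (continuous_xPow x)

end IsMalcevBasis

end Congruence

/-! ### The group law of the pro-`p` completion -/

/-- Continuous functions on `ℤ_p ^ σ` which agree at the integral points are equal. -/
theorem PadicInt.eq_of_eq_intCast {p : ℕ} [Fact p.Prime] {σ Y : Type*} [TopologicalSpace Y]
    [T2Space Y] {F G : (σ → ℤ_[p]) → Y} (hF : Continuous F) (hG : Continuous G)
    (hFG : ∀ s : σ → ℤ, F (fun i => (s i : ℤ_[p])) = G fun i => (s i : ℤ_[p])) (a : σ → ℤ_[p]) :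
    F a = G a := by
  have h1 : DenseRange (Pi.map fun (_ : σ) (n : ℤ) => (n : ℤ_[p])) :=
    DenseRange.piMap fun _ => PadicInt.denseRange_intCast
  exact congrFun (h1.equalizer hF hG (funext hFG)) a

namespace IsMalcevBasis

variable {N : Type*} [Group N] {h : ℕ} {x : Fin h → N}

theorem coord_zpow_of_mem (hx : IsMalcevBasis x) (i : Fin h) {u : N} (hu : u ∈ tailSubgroup x i)
    (n : ℤ) : hx.coord (u ^ n) i = n * hx.coord u i := by
  induction n using Int.induction_on with
  | zero => simp [coord_one]
  | succ n ih =>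
    rw [zpow_add_one, hx.coord_mul_of_mem_right i _ hu, ih]
    ring
  | pred n ih =>
    have h1 := hx.coord_mul_of_mem_right i (u ^ (-(n : ℤ) - 1)) hu
    rw [← zpow_add_one, sub_add_cancel, ih] at h1
    linear_combination -h1

/-- The vector of `p`-adic exponents of an element of `N_p` with respect to a Mal'cev basis. -/
noncomputable def padicCoord (hx : IsMalcevBasis x) {p : ℕ} [Fact p.Prime] (u : ProPCompletion p N) :
    Fin h → ℤ_[p] :=
  (hx.xPowHomeo p).symm u

variable (hx : IsMalcevBasis x) {p : ℕ} [hp : Fact p.Prime]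

theorem xPow_padicCoord (u : ProPCompletion p N) : xPow x (hx.padicCoord u) = u :=
  (hx.xPowHomeo p).apply_symm_apply u

theorem padicCoord_xPow (a : Fin h → ℤ_[p]) : hx.padicCoord (xPow x a) = a :=
  (hx.xPowHomeo p).symm_apply_apply a

theorem padicCoord_toProP (u : N) :
    hx.padicCoord (toProP p u) = fun i => (hx.coord u i : ℤ_[p]) := by
  rw [← hx.padicCoord_xPow fun i => (hx.coord u i : ℤ_[p]), xPow_intCast, intMonomial_coord]

theorem continuous_padicCoord : Continuous (hx.padicCoord (p := p)) :=
  (hx.xPowHomeo p).symm.continuous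

/-- The multiplication polynomials describe the product in `N_p`; in particular they take integral
values at integral points. -/
theorem exists_xPow_mul (hx : IsMalcevBasis x) {f : Fin h → MvPolynomial (Fin h ⊕ Fin h) ℚ}
    (hf : IsMulPolynomials x f) (a b : Fin h → ℤ_[p]) : ∃ c : Fin h → ℤ_[p],
      (fun i => (c i : ℚ_[p])) = evalMul f (fun i => (a i : ℚ_[p])) (fun i => (b i : ℚ_[p])) ∧
        xPow x a * xPow x b = xPow x c := by
  refine ⟨hx.padicCoord (xPow x a * xPow x b), ?_, (hx.xPow_padicCoord _).symm⟩
  funext i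
  have h1 := PadicInt.eq_of_eq_intCast (p := p)
    (F := fun q : Fin h ⊕ Fin h → ℤ_[p] =>
      (hx.padicCoord (xPow x (q ∘ Sum.inl) * xPow x (q ∘ Sum.inr)) i : ℚ_[p]))
    (continuous_subtype_val.comp ((continuous_apply i).comp (hx.continuous_padicCoord.comp
      (((continuous_xPow x).comp (by fun_prop)).mul ((continuous_xPow x).comp (by fun_prop))))))
    (PadicInt.continuous_aeval (f i)) ?_ (Sum.elim a b)
  · simp only [Sum.elim_comp_inl, Sum.elim_comp_inr] at h1
    rw [h1, evalMul]
    congr 2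
    funext j
    cases j <;> rfl
  · intro s
    obtain ⟨c, hc, hc'⟩ := hf (s ∘ Sum.inl) (s ∘ Sum.inr)
    have h2 : ((fun i => ((s i : ℤ) : ℤ_[p])) ∘ Sum.inl : Fin h → ℤ_[p]) =
      fun i => (((s ∘ Sum.inl) i : ℤ) : ℤ_[p]) := rfl
    have h3 : ((fun i => ((s i : ℤ) : ℤ_[p])) ∘ Sum.inr : Fin h → ℤ_[p]) =
      fun i => (((s ∘ Sum.inr) i : ℤ) : ℤ_[p]) := rfl
    rw [h2, h3, xPow_intCast, xPow_intCast, ← map_mul, hc', padicCoord_toProP, coord_intMonomial,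
      PadicInt.aeval_intCast]
    have h4 := congrFun hc i
    have h5 : evalMul f (fun i => (((s ∘ Sum.inl) i : ℤ) : ℚ)) (fun i => (((s ∘ Sum.inr) i : ℤ) : ℚ)) i =
        MvPolynomial.aeval (fun i => (s i : ℚ)) (f i) := by
      rw [evalMul]
      congr 2
      funext j
      cases j <;> rfl
    rw [← h5, ← h4]
    simp

/-- The power polynomials describe the `p`-adic powers in `N_p`. -/
theorem exists_padicPow_xPow (hx : IsMalcevBasis x) {g : Fin h → MvPolynomial (Fin h ⊕ Unit) ℚ}
    (hg : IsPowPolynomials x g) (a : Fin h → ℤ_[p]) (w : ℤ_[p]) : ∃ c : Fin h → ℤ_[p],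
      (fun i => (c i : ℚ_[p])) = evalPow g (fun i => (a i : ℚ_[p])) (w : ℚ_[p]) ∧
        padicPow (xPow x a) w = xPow x c := by
  refine ⟨hx.padicCoord (padicPow (xPow x a) w), ?_, (hx.xPow_padicCoord _).symm⟩
  funext i
  have h1 := PadicInt.eq_of_eq_intCast (p := p)
    (F := fun q : Fin h ⊕ Unit → ℤ_[p] =>
      (hx.padicCoord (padicPow (xPow x (q ∘ Sum.inl)) (q (Sum.inr ()))) i : ℚ_[p]))
    (continuous_subtype_val.comp ((continuous_apply i).comp (hx.continuous_padicCoord.comp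
      (continuous_padicPow.comp
        (((continuous_xPow x).comp (by fun_prop)).prodMk (continuous_apply _))))))
    (PadicInt.continuous_aeval (g i)) ?_ (Sum.elim a fun _ => w)
  · simp only [Sum.elim_comp_inl, Sum.elim_inr] at h1
    rw [h1, evalPow]
    congr 2
    funext j
    cases j <;> rfl
  · intro s
    obtain ⟨c, hc, hc'⟩ := hg (s ∘ Sum.inl) (s (Sum.inr ()))
    have h2 : ((fun i => ((s i : ℤ) : ℤ_[p])) ∘ Sum.inl : Fin h → ℤ_[p]) =
      fun i => (((s ∘ Sum.inl) i : ℤ) : ℤ_[p]) := rfl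
    rw [h2, xPow_intCast, padicPow_intCast, ← map_zpow, hc', padicCoord_toProP, coord_intMonomial,
      PadicInt.aeval_intCast]
    have h4 := congrFun hc i
    have h5 : evalPow g (fun i => (((s ∘ Sum.inl) i : ℤ) : ℚ)) ((s (Sum.inr ()) : ℤ) : ℚ) i =
        MvPolynomial.aeval (fun i => (s i : ℚ)) (g i) := by
      rw [evalPow]
      congr 2
      funext j
      cases j <;> rfl
    rw [← h5, ← h4]
    simp

/-! ### Leading coordinates of products and powers -/

theorem truncate_intCast (k : ℕ) (s : Fin h → ℤ) :
    truncate k (fun i => (s i : ℤ_[p])) = fun i => ((truncate k s i : ℤ) : ℤ_[p]) := by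
  funext i
  simp only [truncate]
  split_ifs <;> simp

theorem continuous_truncate (k : ℕ) : Continuous (truncate k : (Fin h → ℤ_[p]) → Fin h → ℤ_[p]) := by
  refine continuous_pi fun i => ?_
  simp only [truncate]
  split_ifs
  · exact continuous_apply i
  · exact continuous_const

/-- The first coordinates of products of elements `x_k ^ a_k ⋯ x_h ^ a_h`. -/
theorem padicCoord_mul_truncate (hx : IsMalcevBasis x) (k : ℕ) (a b : Fin h → ℤ_[p]) {j : Fin h}
    (hj : (j : ℕ) ≤ k) : hx.padicCoord (xPow x (truncate k a) * xPow x (truncate k b)) j =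
      truncate k a j + truncate k b j := by
  have h1 := PadicInt.eq_of_eq_intCast (p := p)
    (F := fun q : Fin h ⊕ Fin h → ℤ_[p] => hx.padicCoord
      (xPow x (truncate k (q ∘ Sum.inl)) * xPow x (truncate k (q ∘ Sum.inr))) j)
    (G := fun q => truncate k (q ∘ Sum.inl) j + truncate k (q ∘ Sum.inr) j)
    ((continuous_apply j).comp (hx.continuous_padicCoord.comp
      (((continuous_xPow x).comp ((continuous_truncate k).comp (by fun_prop))).mul
        ((continuous_xPow x).comp ((continuous_truncate k).comp (by fun_prop))))))
    (((continuous_apply j).comp ((continuous_truncate k).comp (by fun_prop))).add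
      ((continuous_apply j).comp ((continuous_truncate k).comp (by fun_prop)))) ?_ (Sum.elim a b)
  · simpa only [Sum.elim_comp_inl, Sum.elim_comp_inr] using h1
  · intro s
    simp only [Function.comp_def, truncate_intCast, xPow_intCast, ← map_mul, padicCoord_toProP]
    rw [hx.coord_mul_of_mem_right j _
      (tailSubgroup_antitone x hj (intMonomial_truncate_mem x k _)), coord_intMonomial,
      coord_intMonomial, Int.cast_add]

/-- The first coordinates of powers of elements `x_k ^ a_k ⋯ x_h ^ a_h`. -/
theorem padicCoord_pow_truncate (hx : IsMalcevBasis x) (k : ℕ) (a : Fin h → ℤ_[p]) (w : ℤ_[p])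
    {j : Fin h} (hj : (j : ℕ) ≤ k) :
    hx.padicCoord (padicPow (xPow x (truncate k a)) w) j = w * truncate k a j := by
  have h1 := PadicInt.eq_of_eq_intCast (p := p)
    (F := fun q : Fin h ⊕ Unit → ℤ_[p] => hx.padicCoord
      (padicPow (xPow x (truncate k (q ∘ Sum.inl))) (q (Sum.inr ()))) j)
    (G := fun q => q (Sum.inr ()) * truncate k (q ∘ Sum.inl) j)
    ((continuous_apply j).comp (hx.continuous_padicCoord.comp (continuous_padicPow.comp
      (((continuous_xPow x).comp ((continuous_truncate k).comp (by fun_prop))).prodMk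
        (continuous_apply _)))))
    ((continuous_apply _).mul
      ((continuous_apply j).comp ((continuous_truncate k).comp (by fun_prop)))) ?_
    (Sum.elim a fun _ => w)
  · simpa only [Sum.elim_comp_inl, Sum.elim_inr] using h1
  · intro s
    simp only [Function.comp_def, truncate_intCast, xPow_intCast, padicPow_intCast, ← map_zpow,
      padicCoord_toProP]
    rw [hx.coord_zpow_of_mem j
      (tailSubgroup_antitone x hj (intMonomial_truncate_mem x k _)), coord_intMonomial,
      Int.cast_mul]

theorem truncate_eq_self {F : Type*} [Zero F] {k : ℕ} {a : Fin h → F}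
    (ha : ∀ j : Fin h, (j : ℕ) < k → a j = 0) : truncate k a = a := by
  funext j
  simp only [truncate, ite_eq_left_iff, not_le]
  exact fun hj => (ha j hj).symm

theorem padicMonomial_zero {m : ℕ} (y : Fin m → ProPCompletion p N) : padicMonomial y 0 = 1 := by
  simp [padicMonomial, padicPow_zero]

theorem padicMonomial_truncate (y : Fin h → ProPCompletion p N) (k : Fin h) (l : Fin h → ℤ_[p]) :
    padicMonomial y (truncate k l) =
      padicPow (y k) (l k) * padicMonomial y (truncate (k + 1) l) := by
  have h1 : ∀ (c : Prop) [Decidable c] (u : ProPCompletion p N) (n : ℤ_[p]),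
      padicPow u (if c then n else 0) = if c then padicPow u n else 1 := by
    intro c _ u n
    split_ifs
    · rfl
    · exact padicPow_zero u
  have := List.prod_ofFn_truncate (fun i => padicPow (y i) (l i)) k
  simpa only [padicMonomial, truncate, h1] using this

end IsMalcevBasis

/-! ### The membership algorithm -/

section Membership

variable {N : Type*} [Group N] {h : ℕ} {x : Fin h → N} {p : ℕ} [hp : Fact p.Prime]

theorem rowVector_entries {t : Matrix (Fin h) (Fin h) ℤ_[p]} (ht : t ∈ Tr h p) (k : Fin h) :
    rowVector (entries t) k = fun j => (t k j : ℚ_[p]) := by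
  funext j
  simp only [rowVector, entries]
  split_ifs with hkj
  · rfl
  · rw [ht (not_le.1 hkj)]
    simp

theorem truncate_row {t : Matrix (Fin h) (Fin h) ℤ_[p]} (ht : t ∈ Tr h p) (k : Fin h) :
    truncate k (t k) = t k :=
  IsMalcevBasis.truncate_eq_self fun _ hj => ht (Fin.lt_def.2 hj)

theorem coe_truncate (k : ℕ) (a : Fin h → ℤ_[p]) :
    (fun i => ((truncate k a : Fin h → ℤ_[p]) i : ℚ_[p])) = truncate k fun i => (a i : ℚ_[p]) := by
  funext i
  simp only [truncate]
  split_ifs <;> simp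

namespace IsMalcevBasis

/-- The leading coordinates of `(x ^ t_k) ^ l_k ⋯ (x ^ t_h) ^ l_h` for upper triangular `t`. -/
theorem padicCoord_padicMonomial_truncate (hx : IsMalcevBasis x)
    {t : Matrix (Fin h) (Fin h) ℤ_[p]} (ht : t ∈ Tr h p) (l : Fin h → ℤ_[p]) (k : ℕ) (hk : k ≤ h)
    {j : Fin h} (hj : (j : ℕ) ≤ k) :
    hx.padicCoord (padicMonomial (fun i => xPow x (t i)) (truncate k l)) j =
      if (j : ℕ) = k then l j * t j j else 0 := by
  induction hk using Nat.decreasingInduction generalizing j with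
  | self =>
    rw [if_neg (by omega), truncate_of_le le_rfl, padicMonomial_zero, ← map_one (toProP p),
      padicCoord_toProP, coord_one]
    simp
  | of_succ k hk ih =>
    let k' : Fin h := ⟨k, hk⟩
    have h1 := padicMonomial_truncate (fun i => xPow x (t i)) k' l
    set P := padicPow (xPow x (t k')) (l k')
    set R := padicMonomial (fun i => xPow x (t i)) (truncate (k + 1) l)
    have hP : ∀ i : Fin h, (i : ℕ) ≤ k → hx.padicCoord P i = l k' * t k' i := by
      intro i hi
      have h2 := hx.padicCoord_pow_truncate k (t k') (l k') hi
      have h3 : truncate k (t k') = t k' := truncate_row ht k'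
      rwa [h3] at h2
    have hR : ∀ i : Fin h, (i : ℕ) ≤ k → hx.padicCoord R i = 0 := by
      intro i hi
      rw [ih (Nat.le_succ_of_le hi), if_neg (by omega)]
    have hP' : truncate k (hx.padicCoord P) = hx.padicCoord P := by
      refine truncate_eq_self fun i hi => ?_
      rw [hP i hi.le, ht (show i < k' from hi), mul_zero]
    have hR' : truncate k (hx.padicCoord R) = hx.padicCoord R :=
      truncate_eq_self fun i hi => hR i hi.le
    have h2 := hx.padicCoord_mul_truncate k (hx.padicCoord P) (hx.padicCoord R) hj
    rw [hP', hR', xPow_padicCoord, xPow_padicCoord, hP j hj, hR j hj, add_zero] at h2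
    change hx.padicCoord (padicMonomial (fun i => xPow x (t i)) (truncate (k' : ℕ) l)) j = _
    rw [h1, h2]
    split_ifs with hjk
    · have : j = k' := Fin.ext hjk
      rw [this]
    · rw [ht (show j < k' from Fin.lt_def.2 (lt_of_le_of_ne hj hjk)), mul_zero]

/-- One step of the membership algorithm: if `v = κ_k / t_kk` is integral, then
`x ^ κ = (x ^ t_k) ^ v * x ^ κ'` with `κ'` the next vector of the algorithm. -/
theorem exists_step (hx : IsMalcevBasis x) {f : Fin h → MvPolynomial (Fin h ⊕ Fin h) ℚ}
    {g : Fin h → MvPolynomial (Fin h ⊕ Unit) ℚ} (hf : IsMulPolynomials x f)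
    (hg : IsPowPolynomials x g) {t : Matrix (Fin h) (Fin h) ℤ_[p]} (ht : t ∈ Tr h p) (k : Fin h)
    {κ : Fin h → ℤ_[p]} (hκ : ∀ j : Fin h, (j : ℕ) < k → κ j = 0) {v : ℤ_[p]}
    (hv : v * t k k = κ k) : ∃ κ' : Fin h → ℤ_[p], (∀ j : Fin h, (j : ℕ) < k + 1 → κ' j = 0) ∧
      (fun i => (κ' i : ℚ_[p])) = evalMul f
        (evalPow g (truncate (k + 1) (evalPow g (rowVector (entries t) k) (v : ℚ_[p]))) (-1))
        (truncate (k + 1) fun i => (κ i : ℚ_[p])) ∧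
      xPow x κ = padicPow (xPow x (t k)) v * xPow x κ' := by
  obtain ⟨c, hc, hc'⟩ := hx.exists_padicPow_xPow hg (t k) v
  obtain ⟨d, hd, hd'⟩ := hx.exists_padicPow_xPow hg (truncate (k + 1) c) (-1)
  obtain ⟨κ', hκ₁, hκ₂⟩ := hx.exists_xPow_mul hf d (truncate (k + 1) κ)
  have hck : ∀ j : Fin h, (j : ℕ) ≤ k → c j = v * t k j := by
    intro j hj
    have h2 := hx.padicCoord_pow_truncate k (t k) v hj
    rwa [truncate_row ht, hc', padicCoord_xPow] at h2
  have hdk : ∀ j : Fin h, (j : ℕ) < k + 1 → d j = 0 := by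
    intro j hj
    have h2 := hx.padicCoord_pow_truncate (k + 1) c (-1) hj.le
    rw [hd', padicCoord_xPow] at h2
    rw [h2, truncate, if_neg (by omega), mul_zero]
  refine ⟨κ', fun j hj => ?_, ?_, ?_⟩
  · have h2 := hx.padicCoord_mul_truncate (k + 1) d κ hj.le
    rw [truncate_eq_self hdk, hκ₂, padicCoord_xPow, hdk j hj, zero_add] at h2
    rw [h2, truncate, if_neg (by omega)]
  · rw [hκ₁, hd, coe_truncate, coe_truncate, hc, rowVector_entries ht]
    simp
  · have h3 : xPow x c = padicPow (toProP p (x k)) (κ k) * xPow x (truncate (k + 1) c) := by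
      have h4 := padicMonomial_truncate (fun i => toProP p (x i)) k c
      rw [hck k le_rfl, hv, truncate_eq_self fun j hj => ?_] at h4
      · exact h4
      · rw [hck j hj.le, ht (Fin.lt_def.2 hj), mul_zero]
    have h5 : xPow x κ = padicPow (toProP p (x k)) (κ k) * xPow x (truncate (k + 1) κ) := by
      have h4 := padicMonomial_truncate (fun i => toProP p (x i)) k κ
      rw [truncate_eq_self hκ] at h4
      exact h4
    rw [← hκ₂, ← hd', padicPow_neg_one, hc', h3, h5]
    group

/-- For an upper triangular matrix `t` with nonzero diagonal, an element `x ^ z` of `N_p` is of the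
form `(x ^ t_1) ^ l_1 ⋯ (x ^ t_h) ^ l_h` exactly if all values `v_i` computed by the membership
algorithm are `p`-adic integers. The set of these products need not be a subgroup. -/
theorem xPow_mem_range_iff (hx : IsMalcevBasis x) {f : Fin h → MvPolynomial (Fin h ⊕ Fin h) ℚ}
    {g : Fin h → MvPolynomial (Fin h ⊕ Unit) ℚ} (hf : IsMulPolynomials x f)
    (hg : IsPowPolynomials x g) {t : Matrix (Fin h) (Fin h) ℤ_[p]} (ht : t ∈ Tr h p)
    (ht0 : ∀ i, t i i ≠ 0) (z : Fin h → ℤ_[p]) :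
    xPow x z ∈ Set.range (padicMonomial fun i => xPow x (t i)) ↔
      ∀ i, ‖vValue f g (entries t) (fun j => (z j : ℚ_[p])) i‖ ≤ 1 := by
  set Z : Fin h → ℚ_[p] := fun j => (z j : ℚ_[p]) with hZ
  -- the criterion for the tails of the products, by downward induction on `k`; for `k = h` there is
  -- no vector `k_{h+1}`, and `κ = 0`
  have key : ∀ k ≤ h, ∀ κ : Fin h → ℤ_[p], (∀ j : Fin h, (j : ℕ) < k → κ j = 0) →
      (∀ hk : k < h, (fun i => (κ i : ℚ_[p])) = kVector f g (entries t) Z k hk) →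
      ((∃ l, xPow x κ = padicMonomial (fun i => xPow x (t i)) (truncate k l)) ↔
        ∀ i : Fin h, k ≤ i → ‖vValue f g (entries t) Z i‖ ≤ 1) := by
    intro k hk
    induction hk using Nat.decreasingInduction with
    | self =>
      intro κ hκ _
      have h1 : κ = 0 := funext fun j => hκ j j.2
      refine ⟨fun _ i hi => absurd i.2 (not_lt.2 hi), fun _ => ⟨0, ?_⟩⟩
      rw [truncate_of_le le_rfl, h1, padicMonomial_zero, xPow, padicMonomial_zero]
    | of_succ k hk ih =>
      intro κ hκ hκk
      let k' : Fin h := ⟨k, hk⟩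
      have hκk' := hκk hk
      have ht' : (t k' k' : ℚ_[p]) ≠ 0 := fun hc => ht0 k' (PadicInt.ext hc)
      have hκ' : (κ k' : ℚ_[p]) = kVector f g (entries t) Z k hk k' := congrFun hκk' k'
      have hvk : vValue f g (entries t) Z k' = (κ k' : ℚ_[p]) / t k' k' := by
        rw [hκ']
        rfl
      have hnext : ∀ (v : ℤ_[p]), v * t k' k' = κ k' →
          ∃ κ' : Fin h → ℤ_[p], xPow x κ = padicPow (xPow x (t k')) v * xPow x κ' ∧
            ((∃ l, xPow x κ' = padicMonomial (fun i => xPow x (t i)) (truncate (k + 1) l)) ↔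
              ∀ i : Fin h, k + 1 ≤ i → ‖vValue f g (entries t) Z i‖ ≤ 1) := by
        intro v hv
        obtain ⟨κ', h1, h2, h3⟩ := hx.exists_step hf hg ht k' hκ hv
        refine ⟨κ', h3, ih κ' h1 fun hk1 => ?_⟩
        have hvv : (v : ℚ_[p]) = kVector f g (entries t) Z k hk k' / entries t (TVar.diag k') := by
          rw [← hκ']
          exact (eq_div_iff ht').2 (by rw [← hv, PadicInt.coe_mul])
        rw [h2, hvv, hκk']
        rfl
      constructor
      · rintro ⟨l, hl⟩
        have hl' := congrArg (fun u => hx.padicCoord u k') hl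
        simp only [padicCoord_xPow] at hl'
        rw [hx.padicCoord_padicMonomial_truncate ht l k hk.le le_rfl, if_pos rfl] at hl'
        obtain ⟨κ', h1, h2⟩ := hnext (l k') hl'.symm
        have h3 : xPow x κ' = padicMonomial (fun i => xPow x (t i)) (truncate (k + 1) l) := by
          have h4 := padicMonomial_truncate (fun i => xPow x (t i)) k' l
          exact mul_left_cancel (h1.symm.trans (hl.trans h4))
        intro i hi
        rcases hi.eq_or_lt with hi | hi
        · have : i = k' := Fin.ext hi.symm
          rw [this, hvk, hl', PadicInt.coe_mul, mul_div_cancel_right₀ _ ht']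
          exact (l k').2
        · exact h2.1 ⟨l, h3⟩ i hi
      · intro hv
        obtain ⟨v, hv'⟩ : ∃ v : ℤ_[p], (v : ℚ_[p]) = vValue f g (entries t) Z k' :=
          ⟨⟨_, hv k' le_rfl⟩, rfl⟩
        obtain ⟨κ', h1, h2⟩ := hnext v (PadicInt.ext (by
          rw [PadicInt.coe_mul, hv', hvk, div_mul_cancel₀ _ ht']))
        obtain ⟨l, hl⟩ := h2.2 fun i hi => hv i (Nat.le_of_succ_le hi)
        refine ⟨Function.update l k' v, ?_⟩
        have h4 := padicMonomial_truncate (fun i => xPow x (t i)) k' (Function.update l k' v)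
        rw [Function.update_self] at h4
        refine Eq.trans ?_ h4.symm
        rw [h1, hl]
        congr 2
        funext j
        simp only [truncate]
        split_ifs with hj
        · rw [Function.update_of_ne]
          rintro rfl
          exact absurd hj (by simp [k'])
        · rfl
  have h0 := key 0 (Nat.zero_le h) z (fun j hj => absurd hj (Nat.not_lt_zero _)) fun hk => by
    rw [kVector]
  simp only [truncate_zero, Nat.zero_le, forall_true_left] at h0
  rw [← h0, Set.mem_range]
  exact exists_congr fun l => eq_comm

end IsMalcevBasis

end Membership

/-! ### Specialisation of the membership algorithm -/

section Specialization

variable {h : ℕ} {F : Type*} [Field F] [Algebra ℚ F]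

/-- The monomial `T_11 ^ m_1 ⋯ T_hh ^ m_h`. -/
noncomputable def diagMonomial (m : Fin h → ℕ) : MvPolynomial (TVar h ⊕ Fin h) ℚ :=
  ∏ j, MvPolynomial.X (Sum.inl (TVar.diag j)) ^ m j

theorem diagMonomial_add (m n : Fin h → ℕ) :
    diagMonomial (m + n) = diagMonomial m * diagMonomial n := by
  simp only [diagMonomial, Pi.add_apply, pow_add, Finset.prod_mul_distrib]

theorem diagMonomial_zero : diagMonomial (0 : Fin h → ℕ) = 1 := by
  simp [diagMonomial]

theorem diagMonomial_single (i : Fin h) :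
    diagMonomial (Pi.single i 1) = MvPolynomial.X (Sum.inl (TVar.diag i)) := by
  rw [diagMonomial, Finset.prod_eq_single i] <;> simp +contextual

/-- The rational function `φ` is of the form `P / Q` with `Q` a monomial in `T_11, …, T_hh`, and
takes the value `c` at `(T, Z)`. -/
def SpecializesTo (T : TVar h → F) (Z : Fin h → F) (φ : RatTZ h) (c : F) : Prop :=
  ∃ (P : MvPolynomial (TVar h ⊕ Fin h) ℚ) (m : Fin h → ℕ),
    φ * algebraMap _ (RatTZ h) (diagMonomial m) = algebraMap _ (RatTZ h) P ∧
      c * MvPolynomial.aeval (Sum.elim T Z) (diagMonomial m) = MvPolynomial.aeval (Sum.elim T Z) P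

namespace SpecializesTo

variable {T : TVar h → F} {Z : Fin h → F} {φ ψ : RatTZ h} {c d : F}

theorem of_polynomial (P : MvPolynomial (TVar h ⊕ Fin h) ℚ) :
    SpecializesTo T Z (algebraMap _ (RatTZ h) P) (MvPolynomial.aeval (Sum.elim T Z) P) :=
  ⟨P, 0, by simp [diagMonomial_zero]⟩

theorem zero : SpecializesTo T Z 0 0 := by
  simpa using of_polynomial (T := T) (Z := Z) 0

theorem const (q : ℚ) : SpecializesTo T Z (algebraMap ℚ (RatTZ h) q) (algebraMap ℚ F q) := by
  have := of_polynomial (T := T) (Z := Z) (MvPolynomial.C q)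
  rwa [MvPolynomial.aeval_C, ← MvPolynomial.algebraMap_eq,
    ← IsScalarTower.algebraMap_apply] at this

theorem add (hφ : SpecializesTo T Z φ c) (hψ : SpecializesTo T Z ψ d) :
    SpecializesTo T Z (φ + ψ) (c + d) := by
  obtain ⟨P, m, h1, h2⟩ := hφ
  obtain ⟨Q, n, h3, h4⟩ := hψ
  refine ⟨P * diagMonomial n + Q * diagMonomial m, m + n, ?_, ?_⟩
  · simp only [diagMonomial_add, map_add, map_mul, ← h1, ← h3]
    ring
  · simp only [diagMonomial_add, map_add, map_mul, ← h2, ← h4]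
    ring

theorem mul (hφ : SpecializesTo T Z φ c) (hψ : SpecializesTo T Z ψ d) :
    SpecializesTo T Z (φ * ψ) (c * d) := by
  obtain ⟨P, m, h1, h2⟩ := hφ
  obtain ⟨Q, n, h3, h4⟩ := hψ
  refine ⟨P * Q, m + n, ?_, ?_⟩
  · simp only [diagMonomial_add, map_mul, ← h1, ← h3]
    ring
  · simp only [diagMonomial_add, map_mul, ← h2, ← h4]
    ring

theorem div_diag (hφ : SpecializesTo T Z φ c) (i : Fin h) (hT : T (TVar.diag i) ≠ 0) :
    SpecializesTo T Z (φ / algebraMap (MvPolynomial (TVar h ⊕ Fin h) ℚ) (RatTZ h)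
      (MvPolynomial.X (Sum.inl (TVar.diag i)))) (c / T (TVar.diag i)) := by
  obtain ⟨P, m, h1, h2⟩ := hφ
  refine ⟨P, m + Pi.single i 1, ?_, ?_⟩
  · have hX : algebraMap (MvPolynomial (TVar h ⊕ Fin h) ℚ) (RatTZ h)
        (MvPolynomial.X (Sum.inl (TVar.diag i))) ≠ 0 :=
      (map_ne_zero_iff _ (IsFractionRing.injective _ _)).2 (MvPolynomial.X_ne_zero _)
    rw [diagMonomial_add, diagMonomial_single, map_mul, ← h1]
    field_simp
  · rw [diagMonomial_add, diagMonomial_single, map_mul, ← h2, MvPolynomial.aeval_X, Sum.elim_inl]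
    field_simp

theorem aeval {ι : Type*} {Φ : ι → RatTZ h} {C : ι → F} (hΦ : ∀ i, SpecializesTo T Z (Φ i) (C i))
    (P : MvPolynomial ι ℚ) :
    SpecializesTo T Z (MvPolynomial.aeval Φ P) (MvPolynomial.aeval C P) := by
  induction P using MvPolynomial.induction_on with
  | C q =>
    rw [MvPolynomial.aeval_C, MvPolynomial.aeval_C]
    exact const q
  | add P Q hP hQ =>
    rw [map_add, map_add]
    exact hP.add hQ
  | mul_X P i hP =>
    rw [map_mul, map_mul, MvPolynomial.aeval_X, MvPolynomial.aeval_X]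
    exact hP.mul (hΦ i)

theorem truncate {Φ : Fin h → RatTZ h} {C : Fin h → F} (hΦ : ∀ i, SpecializesTo T Z (Φ i) (C i))
    (k : ℕ) (i : Fin h) : SpecializesTo T Z (_root_.truncate k Φ i) (_root_.truncate k C i) := by
  simp only [_root_.truncate]
  split_ifs
  · exact hΦ i
  · exact zero

end SpecializesTo

/-- The algorithm over `ℚ(T, Z)` divides only by the variables `T_ii`, hence commutes with the
specialisation to any point with nonzero diagonal. -/
theorem specializesTo_kVector (f : Fin h → MvPolynomial (Fin h ⊕ Fin h) ℚ)
    (g : Fin h → MvPolynomial (Fin h ⊕ Unit) ℚ) {T : TVar h → F} {Z : Fin h → F}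
    (hT : ∀ i, T (TVar.diag i) ≠ 0) : ∀ (k : ℕ) (hk : k < h) (i : Fin h),
      SpecializesTo T Z (kVector f g
        (fun ij => algebraMap (MvPolynomial (TVar h ⊕ Fin h) ℚ) (RatTZ h)
          (MvPolynomial.X (Sum.inl ij)))
        (fun j => algebraMap (MvPolynomial (TVar h ⊕ Fin h) ℚ) (RatTZ h)
          (MvPolynomial.X (Sum.inr j))) k hk i) (kVector f g T Z k hk i)
  | 0, hk, i => by
    simpa [kVector] using SpecializesTo.of_polynomial (T := T) (Z := Z) (MvPolynomial.X (Sum.inr i))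
  | k + 1, hk, i => by
    have ih := specializesTo_kVector f g (Z := Z) hT k (Nat.lt_of_succ_lt hk)
    rw [kVector, kVector]
    refine SpecializesTo.aeval ?_ _
    rintro (j | j)
    · refine SpecializesTo.aeval ?_ _
      rintro (j | j)
      · refine SpecializesTo.truncate (fun j => SpecializesTo.aeval ?_ _) _ j
        rintro (j | j)
        · simp only [Sum.elim_inl, rowVector]
          split_ifs with hij
          · simpa using SpecializesTo.of_polynomial (T := T) (Z := Z) (MvPolynomial.X (Sum.inl _))
          · exact SpecializesTo.zero
        · exact (ih _).div_diag _ (hT _)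
      · simpa using SpecializesTo.const (T := T) (Z := Z) (-1)
    · exact SpecializesTo.truncate ih _ j

theorem specializesTo_vRat (f : Fin h → MvPolynomial (Fin h ⊕ Fin h) ℚ)
    (g : Fin h → MvPolynomial (Fin h ⊕ Unit) ℚ) {T : TVar h → F} {Z : Fin h → F}
    (hT : ∀ i, T (TVar.diag i) ≠ 0) (i : Fin h) :
    SpecializesTo T Z (vRat f g i) (vValue f g T Z i) :=
  (specializesTo_kVector f g hT i i.2 i).div_diag i (hT i)

theorem algebraMap_diagMonomial_ne_zero (m : Fin h → ℕ) :
    algebraMap (MvPolynomial (TVar h ⊕ Fin h) ℚ) (RatTZ h) (diagMonomial m) ≠ 0 :=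
  (map_ne_zero_iff _ (IsFractionRing.injective _ _)).2
    (Finset.prod_ne_zero_iff.2 fun _ _ => pow_ne_zero _ (MvPolynomial.X_ne_zero _))

theorem aeval_diagMonomial_ne_zero {T : TVar h → F} {Z : Fin h → F}
    (hT : ∀ i, T (TVar.diag i) ≠ 0) (m : Fin h → ℕ) :
    MvPolynomial.aeval (Sum.elim T Z) (diagMonomial m) ≠ 0 := by
  rw [diagMonomial, map_prod]
  refine Finset.prod_ne_zero_iff.2 fun i _ => ?_
  rw [map_pow, MvPolynomial.aeval_X, Sum.elim_inl]
  exact pow_ne_zero _ (hT i)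

theorem exists_isAlgorithmOutput (f : Fin h → MvPolynomial (Fin h ⊕ Fin h) ℚ)
    (g : Fin h → MvPolynomial (Fin h ⊕ Unit) ℚ) :
    ∃ P Q : Fin h → MvPolynomial (TVar h ⊕ Fin h) ℚ, IsAlgorithmOutput f g P Q := by
  have h1 := specializesTo_vRat f g (F := ℚ) (T := fun _ => 1) (Z := 0) (fun _ => one_ne_zero)
  choose P m hP _ using h1
  exact ⟨P, fun i => diagMonomial (m i), fun i =>
    ⟨⟨m i, rfl⟩, eq_div_of_mul_eq (algebraMap_diagMonomial_ne_zero _) (hP i)⟩⟩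

theorem IsAlgorithmOutput.aeval_ne_zero {f : Fin h → MvPolynomial (Fin h ⊕ Fin h) ℚ}
    {g : Fin h → MvPolynomial (Fin h ⊕ Unit) ℚ} {P Q : Fin h → MvPolynomial (TVar h ⊕ Fin h) ℚ}
    (hPQ : IsAlgorithmOutput f g P Q) {T : TVar h → F} (Z : Fin h → F)
    (hT : ∀ i, T (TVar.diag i) ≠ 0) (i : Fin h) :
    MvPolynomial.aeval (Sum.elim T Z) (Q i) ≠ 0 := by
  obtain ⟨⟨m, hm⟩, -⟩ := hPQ i
  rw [hm]
  exact aeval_diagMonomial_ne_zero hT m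

/-- Any output of the algorithm computes the values of the algorithm run over a field, at every
point with nonzero diagonal. -/
theorem IsAlgorithmOutput.vValue_eq {f : Fin h → MvPolynomial (Fin h ⊕ Fin h) ℚ}
    {g : Fin h → MvPolynomial (Fin h ⊕ Unit) ℚ} {P Q : Fin h → MvPolynomial (TVar h ⊕ Fin h) ℚ}
    (hPQ : IsAlgorithmOutput f g P Q) {T : TVar h → F} (Z : Fin h → F)
    (hT : ∀ i, T (TVar.diag i) ≠ 0) (i : Fin h) :
    vValue f g T Z i = MvPolynomial.aeval (Sum.elim T Z) (P i) /
      MvPolynomial.aeval (Sum.elim T Z) (Q i) := by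
  have hQ0 := hPQ.aeval_ne_zero Z hT i
  obtain ⟨⟨n, hn⟩, hv⟩ := hPQ i
  obtain ⟨P', m, h1, h2⟩ := specializesTo_vRat f g (Z := Z) hT i
  have hQ : algebraMap (MvPolynomial (TVar h ⊕ Fin h) ℚ) (RatTZ h) (Q i) ≠ 0 := by
    rw [hn]
    exact algebraMap_diagMonomial_ne_zero n
  rw [hv, div_mul_eq_mul_div, div_eq_iff hQ, ← map_mul, ← map_mul] at h1
  have h3 := congrArg (MvPolynomial.aeval (Sum.elim T Z))
    (IsFractionRing.injective (MvPolynomial (TVar h ⊕ Fin h) ℚ) (RatTZ h) h1)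
  rw [map_mul, map_mul, ← h2] at h3
  rw [eq_div_iff hQ0]
  exact mul_right_cancel₀ (aeval_diagMonomial_ne_zero hT m) (by rw [h3]; ring)

end Specialization

/-! ### Integrality of polynomials on `ℤ_p` is decided on a finite grid -/

section Grid

variable {p : ℕ} [hp : Fact p.Prime]

/-- A polynomial of degree at most `d` which is integral at `0, …, d` is integral on `ℤ_p`: its
values at the natural numbers are determined by the vanishing of the `(d + 1)`-st differences. -/
theorem Polynomial.norm_eval_le_one {P : Polynomial ℚ_[p]} {d : ℕ} (hd : P.natDegree ≤ d)
    (hP : ∀ n ≤ d, ‖P.eval (n : ℚ_[p])‖ ≤ 1) (a : ℤ_[p]) : ‖P.eval (a : ℚ_[p])‖ ≤ 1 := by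
  have hnat : ∀ n : ℕ, P.eval (n : ℚ_[p]) ∈ PadicInt.subring p := by
    intro n
    induction n using Nat.strong_induction_on with
    | _ n ih =>
      rcases le_or_gt n d with hn | hn
      · exact hP n hn
      · obtain ⟨m, rfl⟩ := Nat.exists_eq_add_of_lt hn
        have h1 := congrFun (Polynomial.fwdDiff_iter_eq_zero_of_degree_lt (P := P) (n := d + 1)
          (by omega)) (m : ℚ_[p])
        rw [fwdDiff_iter_eq_sum_shift, Finset.sum_range_succ, Nat.sub_self, pow_zero,
          Nat.choose_self, Pi.zero_apply] at h1
        have h2 : ((d + m + 1 : ℕ) : ℚ_[p]) = m + (d + 1) • 1 := by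
          push_cast
          simp
          ring
        rw [h2]
        simp only [Nat.cast_one, mul_one, one_smul] at h1
        rw [eq_neg_of_add_eq_zero_right h1]
        refine neg_mem (sum_mem fun k hk => zsmul_mem ?_ _)
        have h3 := ih (m + k) (by have := Finset.mem_range.1 hk; omega)
        simpa using h3
  have hclosed : IsClosed {a : ℤ_[p] | ‖P.eval (a : ℚ_[p])‖ ≤ 1} :=
    isClosed_le (continuous_norm.comp (P.continuous.comp continuous_subtype_val)) continuous_const
  exact PadicInt.denseRange_natCast.induction_on a hclosed fun n => by
    simpa using hnat n

/-- Let `P` be a polynomial in two sets of variables, evaluated at a fixed point `e` in the first one,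
and let `c` be a constant. If `c P(e, n)` is integral for all `n` in the grid `{0, …, deg P} ^ τ`, then
`c P(e, a)` is integral for all `a` in `ℤ_p ^ τ`. The grid does not depend on `p`, `e` or `c`. -/
theorem MvPolynomial.norm_aeval_le_one {κ τ : Type*} [Finite τ] (P : MvPolynomial (κ ⊕ τ) ℚ)
    (e : κ → ℚ_[p]) (c : ℚ_[p])
    (hP : ∀ n : τ → Fin (P.totalDegree + 1),
      ‖c * MvPolynomial.aeval (Sum.elim e fun i => ((n i : ℕ) : ℚ_[p])) P‖ ≤ 1)
    (a : τ → ℤ_[p]) : ‖c * MvPolynomial.aeval (Sum.elim e fun i => (a i : ℚ_[p])) P‖ ≤ 1 := by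
  classical
  have := Fintype.ofFinite τ
  -- the coordinates are released from the grid one at a time
  have key : ∀ (s : Finset τ) (a : τ → ℤ_[p]),
      (∀ i ∉ s, ∃ n : Fin (P.totalDegree + 1), a i = ((n : ℕ) : ℤ_[p])) →
        ‖c * MvPolynomial.aeval (Sum.elim e fun i => (a i : ℚ_[p])) P‖ ≤ 1 := by
    intro s
    induction s using Finset.induction_on with
    | empty =>
      intro a ha
      choose n hn using fun i => ha i (Finset.notMem_empty i)
      simpa [hn] using hP n
    | insert j s hj ih =>
      intro a ha
      let v : κ ⊕ τ → Polynomial ℚ_[p] := Sum.elim (fun i => Polynomial.C (e i)) fun i =>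
        if i = j then Polynomial.X else Polynomial.C (a i : ℚ_[p])
      let R : Polynomial ℚ_[p] := Polynomial.C c *
        MvPolynomial.aeval v (MvPolynomial.map (algebraMap ℚ ℚ_[p]) P)
      have hR : ∀ b : ℤ_[p], R.eval (b : ℚ_[p]) = c * MvPolynomial.aeval
          (Sum.elim e fun i => (Function.update a j b i : ℚ_[p])) P := by
        intro b
        have h1 : (Polynomial.aeval (b : ℚ_[p])) (MvPolynomial.aeval v
            (MvPolynomial.map (algebraMap ℚ ℚ_[p]) P)) = MvPolynomial.aeval
          (Sum.elim e fun i => (Function.update a j b i : ℚ_[p])) P := by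
          rw [← AlgHom.comp_apply, MvPolynomial.comp_aeval, MvPolynomial.aeval_map_algebraMap]
          congr 2
          funext i
          rcases i with i | i
          · simp [v]
          · by_cases hij : i = j
            · subst hij
              simp [v]
            · simp [v, hij]
        rw [Polynomial.eval_mul, Polynomial.eval_C, ← h1, Polynomial.coe_aeval_eq_eval]
      have hdeg : R.natDegree ≤ P.totalDegree := by
        refine (Polynomial.natDegree_C_mul_le _ _).trans ?_
        have h1 := MvPolynomial.aeval_natDegree_le (n := 1) (m := P.totalDegree)
          (MvPolynomial.map (algebraMap ℚ ℚ_[p]) P) ?_ v ?_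
        · simpa using h1
        · exact Finset.sup_mono (MvPolynomial.support_map_subset _ _)
        · rintro (i | i)
          · simp [v]
          · simp only [v, Sum.elim_inr]
            split_ifs <;> simp
      have h2 := Polynomial.norm_eval_le_one hdeg (fun n hn => ?_) (a j)
      · rwa [hR, Function.update_eq_self] at h2
      · have h3 := hR (n : ℤ_[p])
        rw [PadicInt.coe_natCast] at h3
        rw [h3]
        refine ih _ fun i hi => ?_
        by_cases hij : i = j
        · subst hij
          exact ⟨⟨n, by omega⟩, by simp⟩
        · rw [Function.update_of_ne hij]
          exact ha i (by simp [hij, hi])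
  exact key Finset.univ a fun i hi => absurd (Finset.mem_univ i) hi

theorem padicDvd_iff {s r : ℚ_[p]} (hs : s ≠ 0) : PadicDvd s r ↔ ‖r / s‖ ≤ 1 := by
  constructor
  · rintro ⟨c, rfl⟩
    rw [mul_div_cancel_left₀ _ hs]
    exact c.2
  · intro hrs
    obtain ⟨c, hc⟩ : ∃ c : ℤ_[p], (c : ℚ_[p]) = r / s := ⟨⟨_, hrs⟩, rfl⟩
    exact ⟨c, by rw [hc, mul_div_cancel₀ _ hs]⟩

end Grid

/-! ### Good bases -/

section GoodBases

variable {N : Type*} [Group N] {h : ℕ} {x : Fin h → N}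

namespace IsMalcevBasis

variable {p : ℕ} [hp : Fact p.Prime]

theorem padicMonomial_single (y : Fin h → ProPCompletion p N) (i : Fin h) (w : ℤ_[p]) :
    padicMonomial y (Pi.single i w) = padicPow (y i) w := by
  have h1 := padicMonomial_truncate y i (Pi.single i w)
  have h2 : truncate (i : ℕ) (Pi.single i w : Fin h → ℤ_[p]) = Pi.single i w :=
    truncate_eq_self fun j hj => Pi.single_eq_of_ne (M := fun _ => ℤ_[p]) (Fin.lt_def.2 hj).ne w
  have h3 : truncate ((i : ℕ) + 1) (Pi.single i w : Fin h → ℤ_[p]) = 0 := by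
    funext j
    simp only [truncate, Pi.zero_apply, ite_eq_right_iff]
    exact fun hj => Pi.single_eq_of_ne (M := fun _ => ℤ_[p]) (Fin.lt_def.2 hj).ne' w
  rwa [h2, h3, Pi.single_eq_same, padicMonomial_zero, mul_one] at h1

/-- If an open subgroup consists of the products `(x ^ t_1) ^ l_1 ⋯ (x ^ t_h) ^ l_h`, then it
contains `x_i ^ w` for some `w ≠ 0`; comparing leading coordinates shows that `t_ii` divides `w`
once the previous diagonal entries are nonzero. -/
theorem diag_ne_zero (hx : IsMalcevBasis x) {t : Matrix (Fin h) (Fin h) ℤ_[p]}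
    (ht : t ∈ goodBases p x) (i : Fin h) : t i i ≠ 0 := by
  obtain ⟨B, hBo, htr, hB⟩ := ht
  induction i using WellFoundedLT.induction with
  | ind i ih =>
    have hcont : Continuous fun w : ℤ_[p] => xPow x (Pi.single i w) :=
      (continuous_xPow x).comp (continuous_single (A := fun _ => ℤ_[p]) i)
    have hlim := tendsto_pow_atTop_nhds_zero_of_norm_lt_one 
      ((PadicInt.norm_lt_one_iff_dvd (p : ℤ_[p])).2 dvd_rfl)
    have h1 : ∀ᶠ M : ℕ in Filter.atTop, xPow x (Pi.single i ((p : ℤ_[p]) ^ M)) ∈ B := by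
      refine hlim.eventually ((hBo.preimage hcont).mem_nhds ?_)
      rw [Set.mem_preimage, Pi.single_zero, xPow, padicMonomial_zero]
      exact B.one_mem
    obtain ⟨M, hM⟩ := h1.exists
    have hM' : xPow x (Pi.single i ((p : ℤ_[p]) ^ M)) ∈ (B : Set (ProPCompletion p N)) := hM
    rw [hB] at hM'
    obtain ⟨l, hl⟩ := hM'
    -- comparing `k`-th coordinates, provided that `l` vanishes before `k`
    have hcoord : ∀ k : Fin h, truncate k l = l →
        l k * t k k = (Pi.single i ((p : ℤ_[p]) ^ M) : Fin h → ℤ_[p]) k := by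
      intro k hk
      have h2 := hx.padicCoord_padicMonomial_truncate htr l k k.2.le (le_refl (k : ℕ))
      rw [if_pos rfl, hk] at h2
      rw [← h2, ← hx.padicCoord_xPow (Pi.single i ((p : ℤ_[p]) ^ M)), ← hl]
    have hl0 : ∀ k : Fin h, k < i → l k = 0 := by
      intro k
      induction k using WellFoundedLT.induction with
      | ind k ihk =>
        intro hk
        have h2 := hcoord k (truncate_eq_self fun j hj =>
          ihk j (Fin.lt_def.2 hj) (lt_trans (Fin.lt_def.2 hj) hk))
        rw [Pi.single_eq_of_ne hk.ne] at h2
        exact (mul_eq_zero.1 h2).resolve_right (ih k hk)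
    have h3 := hcoord i (truncate_eq_self fun j hj => hl0 j (Fin.lt_def.2 hj))
    rw [Pi.single_eq_same] at h3
    intro h4
    rw [h4, mul_zero] at h3
    exact pow_ne_zero M (Nat.cast_ne_zero.2 hp.out.ne_zero) h3.symm

/-- The products form an open set as soon as the diagonal of `t` does not vanish. -/
theorem isOpen_range (hx : IsMalcevBasis x) {t : Matrix (Fin h) (Fin h) ℤ_[p]} (ht : t ∈ Tr h p)
    (ht0 : ∀ i, t i i ≠ 0) :
    IsOpen (Set.range (padicMonomial fun i => xPow x (t i))) := by
  obtain ⟨f, hf⟩ := hx.exists_isMulPolynomials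
  obtain ⟨g, hg⟩ := hx.exists_isPowPolynomials
  obtain ⟨P, Q, hPQ⟩ := exists_isAlgorithmOutput f g
  have hT : ∀ i, entries t (TVar.diag i) ≠ 0 := fun i hi => ht0 i (PadicInt.ext hi)
  have h1 : Set.range (padicMonomial fun i => xPow x (t i)) = hx.padicCoord (p := p) ⁻¹'
      ⋂ i, {z | ‖vValue f g (entries t) (fun j => (z j : ℚ_[p])) i‖ ≤ 1} := by
    ext u
    rw [Set.mem_preimage, Set.mem_iInter, ← hx.xPow_padicCoord u,
      hx.xPow_mem_range_iff hf hg ht ht0, padicCoord_xPow]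
    rfl
  rw [h1]
  refine (isOpen_iInter_of_finite fun i => ?_).preimage hx.continuous_padicCoord
  have hpoly : ∀ R : MvPolynomial (TVar h ⊕ Fin h) ℚ, Continuous fun z : Fin h → ℤ_[p] =>
      MvPolynomial.aeval (Sum.elim (entries t) fun j => (z j : ℚ_[p])) R := by
    intro R
    have h2 : Continuous fun z : Fin h → ℤ_[p] =>
        (Sum.elim (fun ij : TVar h => t ij.1.1 ij.1.2) z : TVar h ⊕ Fin h → ℤ_[p]) :=
      continuous_pi fun j => by
        rcases j with j | j
        · exact continuous_const
        · exact continuous_apply j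
    have h3 := (PadicInt.continuous_aeval R).comp h2
    refine (continuous_congr fun z => ?_).1 h3
    rw [Function.comp_apply]
    congr 2
    funext j
    cases j <;> rfl
  have h4 : Continuous fun z : Fin h → ℤ_[p] =>
      vValue f g (entries t) (fun j => (z j : ℚ_[p])) i := by
    simp only [fun z : Fin h → ℤ_[p] => hPQ.vValue_eq (fun j => (z j : ℚ_[p])) hT i]
    exact (hpoly _).div (hpoly _) fun z => hPQ.aeval_ne_zero _ hT i
  have h5 := (IsUltrametricDist.isOpen_closedBall (0 : ℚ_[p]) one_ne_zero).preimage h4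
  simpa [Set.preimage] using h5

/-- A matrix is a good basis for an open subgroup exactly if its diagonal does not vanish and the
products `(x ^ t_1) ^ l_1 ⋯ (x ^ t_h) ^ l_h` are closed under quotients. -/
theorem mem_goodBases_iff (hx : IsMalcevBasis x) {t : Matrix (Fin h) (Fin h) ℤ_[p]} :
    t ∈ goodBases p x ↔ t ∈ Tr h p ∧ (∀ i, t i i ≠ 0) ∧ ∀ l : Fin h ⊕ Fin h → ℤ_[p],
      padicMonomial (fun i => xPow x (t i)) (fun i => l (Sum.inl i)) *
        (padicMonomial (fun i => xPow x (t i)) fun i => l (Sum.inr i))⁻¹ ∈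
          Set.range (padicMonomial fun i => xPow x (t i)) := by
  constructor
  · intro ht
    refine ⟨ht.choose_spec.2.1, hx.diag_ne_zero ht, fun l => ?_⟩
    obtain ⟨B, -, -, hB⟩ := ht
    have hmem : ∀ l, padicMonomial (fun i => xPow x (t i)) l ∈ B := fun l => by
      rw [← SetLike.mem_coe, hB]
      exact ⟨l, rfl⟩
    rw [← hB]
    exact mul_mem (hmem _) (inv_mem (hmem _))
  · rintro ⟨ht, ht0, hcl⟩
    refine ⟨Subgroup.ofDiv (Set.range (padicMonomial fun i => xPow x (t i)))
      (Set.range_nonempty _) ?_, hx.isOpen_range ht ht0, ht, rfl⟩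
    rintro _ ⟨l, rfl⟩ _ ⟨l', rfl⟩
    exact hcl (Sum.elim l l')

theorem mem_normalGoodBases_iff (hx : IsMalcevBasis x) {t : Matrix (Fin h) (Fin h) ℤ_[p]} :
    t ∈ normalGoodBases p x ↔ t ∈ goodBases p x ∧ ∀ l : Fin h ⊕ Fin h → ℤ_[p],
      xPow x (fun i => l (Sum.inl i)) *
        padicMonomial (fun i => xPow x (t i)) (fun i => l (Sum.inr i)) *
        (xPow x fun i => l (Sum.inl i))⁻¹ ∈ Set.range (padicMonomial fun i => xPow x (t i)) := by
  constructor
  · rintro ⟨B, hn, ho, hB⟩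
    refine ⟨⟨B, ho, hB⟩, fun l => ?_⟩
    have h1 : padicMonomial (fun i => xPow x (t i)) (fun i => l (Sum.inr i)) ∈
        (B : Set (ProPCompletion p N)) := hB.2 ▸ ⟨_, rfl⟩
    have h2 := hn.conj_mem _ h1 (xPow x fun i => l (Sum.inl i))
    have h3 : _ ∈ (B : Set (ProPCompletion p N)) := h2
    rwa [hB.2] at h3
  · rintro ⟨⟨B, ho, hB⟩, hl⟩
    refine ⟨B, ⟨fun b hb u => ?_⟩, ho, hB⟩
    have hb' : b ∈ (B : Set (ProPCompletion p N)) := hb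
    rw [hB.2] at hb'
    obtain ⟨l, rfl⟩ := hb'
    have h1 := hl (Sum.elim (hx.padicCoord u) l)
    simp only [Sum.elim_inl, Sum.elim_inr] at h1
    change _ ∈ (B : Set (ProPCompletion p N))
    rw [hB.2]
    rwa [show (fun i => hx.padicCoord u i) = hx.padicCoord u from rfl, xPow_padicCoord] at h1

end IsMalcevBasis

theorem padicPow_mem_topologicalClosure {p : ℕ} [Fact p.Prime]
    {H : Subgroup (ProPCompletion p N)} {u : ProPCompletion p N} (hu : u ∈ H) (a : ℤ_[p]) :
    padicPow u a ∈ H.topologicalClosure := by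
  have h1 : IsClosed {a : ℤ_[p] | padicPow u a ∈ H.topologicalClosure} :=
    H.isClosed_topologicalClosure.preimage
      (continuous_padicPow.comp (continuous_const.prodMk continuous_id))
  refine PadicInt.denseRange_intCast.induction_on a h1 fun n => ?_
  rw [padicPow_intCast]
  exact H.le_topologicalClosure (zpow_mem hu n)

theorem closedSpan_eq_range {p : ℕ} [Fact p.Prime] {t : Matrix (Fin h) (Fin h) ℤ_[p]}
    (ht : t ∈ goodBases p x) :
    closedSpan x t = Set.range (padicMonomial fun i => xPow x (t i)) := by
  obtain ⟨B, ho, -, hB⟩ := ht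
  refine Set.Subset.antisymm ?_ ?_
  · rw [← hB]
    refine closure_minimal ?_ (Subgroup.isClosed_of_isOpen B ho)
    refine (Subgroup.closure_le B).2 ?_
    rintro _ ⟨i, rfl⟩
    rw [hB]
    exact ⟨Pi.single i 1, by
      simp only [IsMalcevBasis.padicMonomial_single, padicPow_one]⟩
  · rintro _ ⟨l, rfl⟩
    refine Subgroup.list_prod_mem
      (Subgroup.closure (Set.range fun i => xPow x (t i))).topologicalClosure fun g hg => ?_
    obtain ⟨j, rfl⟩ := List.mem_ofFn.1 hg
    exact padicPow_mem_topologicalClosure (Subgroup.subset_closure (Set.mem_range_self j)) _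

/-! ### Polynomial families of elements -/

/-- A family of elements of the groups `N_p`, depending on an upper triangular matrix `t` and on
parameters `l ∈ ℤ_p ^ τ`, whose exponents are given by polynomials in `(t, l)` over `ℚ` which do not
depend on `p`. -/
def IsPadicPolyFamily (x : Fin h → N) {τ : Type*}
    (u : ∀ (p : ℕ) [Fact p.Prime], Matrix (Fin h) (Fin h) ℤ_[p] → (τ → ℤ_[p]) →
      ProPCompletion p N) : Prop :=
  ∃ C : Fin h → MvPolynomial (TVar h ⊕ τ) ℚ, ∀ (p : ℕ) [Fact p.Prime],
    ∀ t ∈ Tr h p, ∀ l : τ → ℤ_[p], ∃ c : Fin h → ℤ_[p],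
      (fun i => (c i : ℚ_[p])) =
        (fun i => MvPolynomial.aeval (Sum.elim (entries t) fun j => (l j : ℚ_[p])) (C i)) ∧
      u p t l = xPow x c

namespace IsPadicPolyFamily

variable {τ : Type*} {u v : ∀ (p : ℕ) [Fact p.Prime], Matrix (Fin h) (Fin h) ℤ_[p] →
  (τ → ℤ_[p]) → ProPCompletion p N}

theorem aeval_comp_elim {κ ι ι' F : Type*} [Field F] [Algebra ℚ F] (e : κ → F)
    (A : ι → MvPolynomial κ ℚ) (B : ι' → MvPolynomial κ ℚ) (P : MvPolynomial (ι ⊕ ι') ℚ) :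
    MvPolynomial.aeval e (MvPolynomial.aeval (Sum.elim A B) P) = MvPolynomial.aeval
      (Sum.elim (fun i => MvPolynomial.aeval e (A i)) fun i => MvPolynomial.aeval e (B i)) P := by
  rw [← AlgHom.comp_apply, MvPolynomial.comp_aeval]
  congr 2
  funext i
  cases i <;> rfl

theorem mul (hx : IsMalcevBasis x) (hu : IsPadicPolyFamily x u) (hv : IsPadicPolyFamily x v) :
    IsPadicPolyFamily x fun p _ t l => u p t l * v p t l := by
  obtain ⟨f, hf⟩ := hx.exists_isMulPolynomials
  obtain ⟨A, hA⟩ := hu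
  obtain ⟨B, hB⟩ := hv
  refine ⟨fun i => MvPolynomial.aeval (Sum.elim A B) (f i), fun p _ t ht l => ?_⟩
  obtain ⟨a, ha, ha'⟩ := hA p t ht l
  obtain ⟨b, hb, hb'⟩ := hB p t ht l
  obtain ⟨c, hc, hc'⟩ := hx.exists_xPow_mul hf a b
  refine ⟨c, ?_, (congrArg₂ _ ha' hb').trans hc'⟩
  rw [hc, ha, hb]
  funext i
  rw [aeval_comp_elim]
  rfl

theorem padicPow (hx : IsMalcevBasis x) (hu : IsPadicPolyFamily x u)
    {e : ∀ (p : ℕ) [Fact p.Prime], (τ → ℤ_[p]) → ℤ_[p]} (E : MvPolynomial (TVar h ⊕ τ) ℚ)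
    (hE : ∀ (p : ℕ) [Fact p.Prime] (t : Matrix (Fin h) (Fin h) ℤ_[p]) (l : τ → ℤ_[p]),
      (e p l : ℚ_[p]) =
        MvPolynomial.aeval (Sum.elim (entries t) fun j => (l j : ℚ_[p])) E) :
    IsPadicPolyFamily x fun p _ t l => _root_.padicPow (u p t l) (e p l) := by
  obtain ⟨g, hg⟩ := hx.exists_isPowPolynomials
  obtain ⟨A, hA⟩ := hu
  refine ⟨fun i => MvPolynomial.aeval (Sum.elim A fun _ => E) (g i), fun p _ t ht l => ?_⟩
  obtain ⟨a, ha, ha'⟩ := hA p t ht l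
  obtain ⟨c, hc, hc'⟩ := hx.exists_padicPow_xPow hg a (e p l)
  refine ⟨c, ?_, (congrArg (_root_.padicPow · _) ha').trans hc'⟩
  rw [hc, ha, hE p t l]
  funext i
  rw [aeval_comp_elim]
  rfl

theorem inv (hx : IsMalcevBasis x) (hu : IsPadicPolyFamily x u) :
    IsPadicPolyFamily x fun p _ t l => (u p t l)⁻¹ := by
  simp only [← padicPow_neg_one]
  exact hu.padicPow hx (e := fun p _ _ => -1) (MvPolynomial.C (-1)) fun p _ t l => by simp

theorem xPow_variables (φ : Fin h → τ) :
    IsPadicPolyFamily x fun _ _ _ l => xPow x fun i => l (φ i) :=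
  ⟨fun i => MvPolynomial.X (Sum.inr (φ i)), fun p _ t _ l => ⟨fun i => l (φ i), by simp, rfl⟩⟩

theorem xPow_row (i : Fin h) :
    IsPadicPolyFamily (τ := τ) x fun _ _ t _ => xPow x (t i) := by
  refine ⟨rowVector (fun ij => MvPolynomial.X (Sum.inl ij)) i, fun p _ t ht l => ⟨t i, ?_, rfl⟩⟩
  rw [← rowVector_entries ht]
  funext j
  simp only [rowVector]
  split_ifs <;> simp

theorem list_prod (hx : IsMalcevBasis x) : ∀ {m : ℕ}
    (u : Fin m → ∀ (p : ℕ) [Fact p.Prime], Matrix (Fin h) (Fin h) ℤ_[p] →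
      (τ → ℤ_[p]) → ProPCompletion p N), (∀ i, IsPadicPolyFamily x (u i)) →
      IsPadicPolyFamily x fun p _ t l => (List.ofFn fun i => u i p t l).prod
  | 0, _, _ => ⟨0, fun p _ t _ l => ⟨0, by funext i; simp, by
      rw [xPow, IsMalcevBasis.padicMonomial_zero]; simp⟩⟩
  | m + 1, u, hu => by
    simp only [List.ofFn_succ, List.prod_cons]
    exact (hu 0).mul hx (list_prod hx (fun i => u i.succ) fun i => hu i.succ)

theorem padicMonomial_rows (hx : IsMalcevBasis x) (φ : Fin h → τ) :
    IsPadicPolyFamily x fun _ _ t l =>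
      padicMonomial (fun i => xPow x (t i)) fun i => l (φ i) :=
  list_prod hx (fun i _ _ t l => _root_.padicPow (xPow x (t i)) (l (φ i))) fun i =>
    (xPow_row i).padicPow hx (e := fun _ _ l => l (φ i)) (MvPolynomial.X (Sum.inr (φ i)))
      fun _ _ _ _ => by simp

/-- The matrices `t` for which all members of a polynomial family are of the form
`(x ^ t_1) ^ l_1 ⋯ (x ^ t_h) ^ l_h` are described by finitely many divisibility conditions: the
membership algorithm turns this into the integrality of polynomials in the parameters, which has to
be tested on a finite grid of parameters only. -/
theorem exists_coneSet (hx : IsMalcevBasis x) [Finite τ] (hu : IsPadicPolyFamily x u) :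
    ∃ (n : ℕ) (r s : Fin n → MvPolynomial (TVar h) ℚ), ∀ (p : ℕ) [Fact p.Prime], coneSet p r s =
      {t | t ∈ Tr h p ∧ (∀ i, t i i ≠ 0) ∧
        ∀ l, u p t l ∈ Set.range (padicMonomial fun i => xPow x (t i))} := by
  classical
  have := Fintype.ofFinite τ
  obtain ⟨f, hf⟩ := hx.exists_isMulPolynomials
  obtain ⟨g, hg⟩ := hx.exists_isPowPolynomials
  obtain ⟨P, Q, hPQ⟩ := exists_isAlgorithmOutput f g
  obtain ⟨C, hC⟩ := hu
  let R : Fin h → MvPolynomial (TVar h ⊕ τ) ℚ := fun i =>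
    MvPolynomial.aeval (Sum.elim (fun ij => MvPolynomial.X (Sum.inl ij)) C) (P i)
  let ι := Σ i : Fin h, τ → Fin ((R i).totalDegree + 1)
  let r : ι → MvPolynomial (TVar h) ℚ := fun k => MvPolynomial.aeval
    (Sum.elim (fun ij => MvPolynomial.X ij) fun j => MvPolynomial.C ((k.2 j : ℕ) : ℚ)) (R k.1)
  let s : ι → MvPolynomial (TVar h) ℚ := fun k => MvPolynomial.aeval
    (Sum.elim (fun ij => MvPolynomial.X ij) fun _ => 0) (Q k.1)
  let e := Fintype.equivFin ι
  refine ⟨Fintype.card ι, fun k => r (e.symm k), fun k => s (e.symm k), fun p _ => ?_⟩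
  ext t
  simp only [coneSet, Set.mem_ofPred_eq, Finset.prod_ne_zero_iff, Finset.mem_univ, forall_true_left]
  refine and_congr_right fun ht => and_congr_right fun ht0 => ?_
  have hT : ∀ i, entries t (TVar.diag i) ≠ 0 := fun i hi => ht0 i (PadicInt.ext hi)
  have hr : ∀ k : ι, MvPolynomial.aeval (entries t) (r k) = MvPolynomial.aeval
      (Sum.elim (entries t) fun j => ((k.2 j : ℕ) : ℚ_[p])) (R k.1) := by
    intro k
    simp only [r]
    rw [aeval_comp_elim]
    simp
  have hs : ∀ (k : ι) (Z : Fin h → ℚ_[p]), MvPolynomial.aeval (entries t) (s k) =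
      MvPolynomial.aeval (Sum.elim (entries t) Z) (Q k.1) := by
    intro k Z
    obtain ⟨⟨m, hm⟩, -⟩ := hPQ k.1
    simp only [s]
    rw [aeval_comp_elim, hm]
    simp
  have hs0 : ∀ k, MvPolynomial.aeval (entries t) (s k) ≠ 0 := by
    intro k
    rw [hs k 0]
    exact hPQ.aeval_ne_zero 0 hT k.1
  have hmem : ∀ l, u p t l ∈ Set.range (padicMonomial fun i => xPow x (t i)) ↔
      ∀ i, ‖(MvPolynomial.aeval (Sum.elim (entries t) (0 : Fin h → ℚ_[p])) (Q i))⁻¹ *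
        MvPolynomial.aeval (Sum.elim (entries t) fun j => (l j : ℚ_[p])) (R i)‖ ≤ 1 := by
    intro l
    obtain ⟨c, hc, hc'⟩ := hC p t ht l
    rw [hc', hx.xPow_mem_range_iff hf hg ht ht0]
    refine forall_congr' fun i => ?_
    have hR : MvPolynomial.aeval (Sum.elim (entries t) fun j => (l j : ℚ_[p])) (R i) =
        MvPolynomial.aeval (Sum.elim (entries t) fun i => (c i : ℚ_[p])) (P i) := by
      simp only [R]
      rw [aeval_comp_elim, ← hc]
      simp only [MvPolynomial.aeval_X, Sum.elim_inl]
    rw [hPQ.vValue_eq _ hT, ← hs ⟨i, 0⟩ 0, hs ⟨i, 0⟩ fun j => (c j : ℚ_[p]), div_eq_inv_mul, hR]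
  simp only [hmem]
  constructor
  · intro hcone l i
    refine MvPolynomial.norm_aeval_le_one (R i) (entries t) _ (fun n => ?_) l
    have h1 := hcone (e ⟨i, n⟩)
    rw [Equiv.symm_apply_apply, padicDvd_iff (hs0 _), hr, hs _ 0, div_eq_inv_mul] at h1
    exact h1
  · intro hl k
    have h1 := hl (fun j => (((e.symm k).2 j : ℕ) : ℤ_[p])) (e.symm k).1
    rw [padicDvd_iff (hs0 _), hr, hs _ 0, div_eq_inv_mul]
    simpa using h1

end IsPadicPolyFamily

theorem coneSet_inter {p : ℕ} [Fact p.Prime] {m n : ℕ} (r s : Fin m → MvPolynomial (TVar h) ℚ)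
    (r' s' : Fin n → MvPolynomial (TVar h) ℚ) :
    coneSet p r s ∩ coneSet p r' s' = coneSet p (Fin.append r r') (Fin.append s s') := by
  ext t
  simp only [coneSet, Set.mem_inter_iff, Set.mem_ofPred_eq]
  constructor
  · rintro ⟨⟨h1, h2, h3⟩, -, -, h4⟩
    refine ⟨h1, h2, fun i => ?_⟩
    refine Fin.addCases (fun i => ?_) (fun i => ?_) i
    · simpa using h3 i
    · simpa using h4 i
  · rintro ⟨h1, h2, h3⟩
    exact ⟨⟨h1, h2, fun i => by simpa using h3 (Fin.castAdd n i)⟩,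
      h1, h2, fun i => by simpa using h3 (Fin.natAdd m i)⟩

end GoodBases

theorem mainTheorem3 {N : Type*} [Group N] [Group.FG N] [Group.IsNilpotent N]
    (htf : ∀ y : N, y ≠ 1 → ¬ IsOfFinOrder y)
    {h : ℕ} (x : Fin h → N) (hx : IsMalcevBasis x) :
    -- the polynomials of the Mal'cev basis exist
    ((∃ f : Fin h → MvPolynomial (Fin h ⊕ Fin h) ℚ, IsMulPolynomials x f) ∧
      ∃ g : Fin h → MvPolynomial (Fin h ⊕ Unit) ℚ, IsPowPolynomials x g) ∧
    -- the algorithm produces polynomials and tests membership, for every prime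
    (∀ (f : Fin h → MvPolynomial (Fin h ⊕ Fin h) ℚ) (g : Fin h → MvPolynomial (Fin h ⊕ Unit) ℚ),
      IsMulPolynomials x f → IsPowPolynomials x g →
      (∃ P Q : Fin h → MvPolynomial (TVar h ⊕ Fin h) ℚ, IsAlgorithmOutput f g P Q) ∧
      ∀ P Q : Fin h → MvPolynomial (TVar h ⊕ Fin h) ℚ, IsAlgorithmOutput f g P Q →
        ∀ (p : ℕ) [Fact p.Prime], ∀ t ∈ goodBases p x, ∀ z : Fin h → ℤ_[p],
          xPow x z ∈ closedSpan x t ↔ ∀ i, PadicDvd (evalTZ (Q i) t z) (evalTZ (P i) t z)) ∧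
    -- good bases of open subgroups
    (∃ (n : ℕ) (r s : Fin n → MvPolynomial (TVar h) ℚ),
      ∀ (p : ℕ) [Fact p.Prime], goodBases p x = coneSet p r s) ∧
    -- good bases of open normal subgroups
    (∃ (n : ℕ) (r s : Fin n → MvPolynomial (TVar h) ℚ),
      ∀ (p : ℕ) [Fact p.Prime], normalGoodBases p x = coneSet p r s) := by
  have hgood : ∃ (n : ℕ) (r s : Fin n → MvPolynomial (TVar h) ℚ),
      ∀ (p : ℕ) [Fact p.Prime], goodBases p x = coneSet p r s := by
    obtain ⟨n, r, s, hrs⟩ := IsPadicPolyFamily.exists_coneSet hx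
      ((IsPadicPolyFamily.padicMonomial_rows hx Sum.inl).mul hx
        ((IsPadicPolyFamily.padicMonomial_rows hx (Sum.inr : Fin h → Fin h ⊕ Fin h)).inv hx))
    refine ⟨n, r, s, fun p _ => ?_⟩
    ext t
    rw [hrs, hx.mem_goodBases_iff]
    rfl
  refine ⟨⟨hx.exists_isMulPolynomials, hx.exists_isPowPolynomials⟩, fun f g hf hg =>
    ⟨exists_isAlgorithmOutput f g, fun P Q hPQ p _ t ht z => ?_⟩, hgood, ?_⟩
  · have ht0 := hx.diag_ne_zero ht
    have hT : ∀ i, entries t (TVar.diag i) ≠ 0 := fun i hi => ht0 i (PadicInt.ext hi)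
    rw [closedSpan_eq_range ht,
      hx.xPow_mem_range_iff hf hg (hx.mem_goodBases_iff.1 ht).1 ht0]
    refine forall_congr' fun i => ?_
    rw [hPQ.vValue_eq _ hT i, evalTZ, evalTZ, padicDvd_iff (hPQ.aeval_ne_zero _ hT i)]
  · obtain ⟨n, r, s, hrs⟩ := hgood
    obtain ⟨n', r', s', hrs'⟩ := IsPadicPolyFamily.exists_coneSet hx
      (((IsPadicPolyFamily.xPow_variables Sum.inl).mul hx
        (IsPadicPolyFamily.padicMonomial_rows hx Sum.inr)).mul hx
          ((IsPadicPolyFamily.xPow_variables (Sum.inl : Fin h → Fin h ⊕ Fin h)).inv hx))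
    refine ⟨n + n', Fin.append r r', Fin.append s s', fun p _ => ?_⟩
    rw [← coneSet_inter, ← hrs, hrs']
    ext t
    rw [hx.mem_normalGoodBases_iff, Set.mem_inter_iff]
    refine and_congr_right fun ht => ?_
    exact ⟨fun hl => ⟨(hx.mem_goodBases_iff.1 ht).1, hx.diag_ne_zero ht, hl⟩, fun hl => hl.2.2⟩
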